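/- Let $L,\rho_1,\rho_2,k,b,\gamma>0$. Let $L^2(0,L)$ be the space of real square-integrable functions on $(0,L)$, with inner product $\langle\cdot,\cdot\rangle$, let $H^1(0,L)$, $H^2(0,L)$ be the usual Sobolev spaces (weak derivatives are denoted by a subscript $x$, and point values $u(0)$, $u(L)$ of $u\in H^1(0,L)$ are those of its continuous representative on $[0,L]$), and let $H^1_*(0,L)=\{u\in H^1(0,L): u(0)=0\}$. Let $$\mathcal H=[H^1_*(0,L)\times L^2(0,L)]^3\times\mathbb R^3,$$ with elements $U=(w,\Psi_1,\xi,\Psi_2,s,\Psi_3,\Psi_4,\Psi_5,\Psi_6)$, be endowed with the inner product $$\begin{aligned}\langle U,U^\sharp\rangle_{\mathcal H}=\;&3\rho_1\langle\Psi_1,\Psi_1^\sharp\rangle+3\rho_2\langle\Psi_2,\Psi_2^\sharp\rangle+\rho_2\langle\Psi_3,\Psi_3^\sharp\rangle+3b\langle\xi_x,\xi_x^\sharp\rangle+b\langle s_x,s_x^\sharp\rangle+\gamma\langle s,s^\sharp\rangle\\&+3k\langle w_x+\xi+s,\,w_x^\sharp+\xi^\sharp+s^\sharp\rangle+3k\Psi_4\Psi_4^\sharp+3b\Psi_5\Psi_5^\sharp+b\Psi_6\Psi_6^\sharp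 ,\end{aligned}$$ which makes it a real Hilbert space. Let $\mathcal A:D(\mathcal A)\subset\mathcal H\to\mathcal H$ be the operator whose domain $D(\mathcal A)$ consists of all $U\in\mathcal H$ such that $w,\xi,s\in H^2(0,L)\cap H^1_*(0,L)$, $\Psi_1,\Psi_2,\Psi_3\in H^1_*(0,L)$, $\Psi_4=\Psi_1(L)$, $\Psi_5=\Psi_2(L)$, $\Psi_6=\Psi_3(L)$, and which is given there by $$\mathcal A U=\Big(\Psi_1,\ \tfrac{k}{\rho_1}(w_x+\xi+s)_x,\ \Psi_2,\ \tfrac1{\rho_2}\big[b\xi_{xx}-k(w_x+\xi+s)\big],\ \Psi_3,\ \tfrac1{\rho_2}\big[bs_{xx}-3k(w_x+\xi+s)-\gamma s\big],$$ $$\qquad -(w_x(L)+\xi(L)+s(L)),\ -\xi_x(L),\ -s_x(L)\Big).$$ Then $\mathcal A$ is skew-adjoint, i.e. $D(\mathcal A)$ is dense in $\mathcal H$ and $\mathcal A^*=-\mathcal A$ with $D(\mathcal A^*)=D(\mathcal A)$. Moreover, $\mathcal A$ is the infinitesimal generator of a $C_0$-group $\{S(t)\}_{t\in\mathbb R}$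 of bounded linear operators on $\mathcal H$, every $S(t)$ being an isometry. -/

import Mathlib

open MeasureTheory Set Filter Topology
open scoped ContDiff

noncomputable section
namespace LaminatedBeam

/-- The Lebesgue space `L²(0, L)` of real-valued functions. -/
abbrev L2 (L : ℝ) : Type := Lp ℝ 2 (volume.restrict (Ioo (0 : ℝ) L))

/-- Test functions on the open interval: `φ ∈ C_c^∞(0, L)`. -/
structure IsTestFun (L : ℝ) (φ : ℝ → ℝ) : Prop where
  contDiff : ContDiff ℝ ∞ φ
  hasCompactSupport : HasCompactSupport φ
  tsupport_subset : tsupport φ ⊆ Ioo 0 L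

/-- `g ∈ L²(0, L)` is the weak derivative of `u ∈ L²(0, L)`. -/
def HasWeakDeriv {L : ℝ} (u g : L2 L) : Prop :=
  ∀ φ : ℝ → ℝ, IsTestFun L φ →
    ∫ x in Ioo 0 L, u x * deriv φ x = -∫ x in Ioo 0 L, g x * φ x

theorem integrable_coe {L : ℝ} (u : L2 L) : IntegrableOn (u : ℝ → ℝ) (Ioo 0 L) :=
  (Lp.memLp u).integrable (by norm_num)

theorem integrable_mul_cont {L : ℝ} (u : L2 L) {φ : ℝ → ℝ} (h : Continuous φ)
    (hc : HasCompactSupport φ) : IntegrableOn (fun x => u x * φ x) (Ioo 0 L) :=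
  (Lp.memLp u).integrable_mul (p := 2) (q := 2) (h.memLp_of_hasCompactSupport hc)

theorem IsTestFun.deriv_cont {L : ℝ} {φ : ℝ → ℝ} (h : IsTestFun L φ) :
    Continuous (deriv φ) := h.contDiff.continuous_deriv (by simp)

theorem HasWeakDeriv.add {L : ℝ} {u v g h : L2 L} (hu : HasWeakDeriv u g)
    (hv : HasWeakDeriv v h) : HasWeakDeriv (u + v) (g + h) := by
  intro φ hφ
  have e1 : ∫ x in Ioo 0 L, (u + v) x * deriv φ x
      = ∫ x in Ioo 0 L, (u x * deriv φ x + v x * deriv φ x) := by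
    apply integral_congr_ae
    filter_upwards [Lp.coeFn_add u v] with x hx
    rw [hx, Pi.add_apply, add_mul]
  have e2 : ∫ x in Ioo 0 L, (g + h) x * φ x
      = ∫ x in Ioo 0 L, (g x * φ x + h x * φ x) := by
    apply integral_congr_ae
    filter_upwards [Lp.coeFn_add g h] with x hx
    rw [hx, Pi.add_apply, add_mul]
  have c := hφ.contDiff.continuous
  have s := hφ.hasCompactSupport
  rw [e1, e2, integral_add (integrable_mul_cont u hφ.deriv_cont s.deriv)
    (integrable_mul_cont v hφ.deriv_cont s.deriv),
    integral_add (integrable_mul_cont g c s) (integrable_mul_cont h c s), hu φ hφ, hv φ hφ]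
  ring

theorem HasWeakDeriv.smul {L : ℝ} {u g : L2 L} (c : ℝ) (hu : HasWeakDeriv u g) :
    HasWeakDeriv (c • u) (c • g) := by
  intro φ hφ
  have e1 : ∫ x in Ioo 0 L, (c • u) x * deriv φ x
      = ∫ x in Ioo 0 L, c * (u x * deriv φ x) := by
    apply integral_congr_ae
    filter_upwards [Lp.coeFn_smul c u] with x hx
    rw [hx, Pi.smul_apply, smul_eq_mul, mul_assoc]
  have e2 : ∫ x in Ioo 0 L, (c • g) x * φ x
      = ∫ x in Ioo 0 L, c * (g x * φ x) := by
    apply integral_congr_ae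
    filter_upwards [Lp.coeFn_smul c g] with x hx
    rw [hx, Pi.smul_apply, smul_eq_mul, mul_assoc]
  rw [e1, e2, integral_const_mul, integral_const_mul, hu φ hφ]
  ring

theorem HasWeakDeriv.zero {L : ℝ} : HasWeakDeriv (0 : L2 L) 0 := by
  intro φ hφ
  have e : ∀ f : ℝ → ℝ, ∫ x in Ioo 0 L, (0 : L2 L) x * f x = 0 := fun f => by
    apply integral_eq_zero_of_ae
    filter_upwards [Lp.coeFn_zero ℝ 2 (volume.restrict (Ioo (0 : ℝ) L))] with x hx
    rw [hx, Pi.zero_apply, zero_mul]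
  rw [e, e, neg_zero]

theorem HasWeakDeriv.unique {L : ℝ} {u g h : L2 L} (hg : HasWeakDeriv u g)
    (hh : HasWeakDeriv u h) : g = h := by
  have key : ∀ᵐ x, x ∈ Ioo 0 L → (g x - h x) = 0 := by
    refine isOpen_Ioo.ae_eq_zero_of_integral_contDiff_smul_eq_zero
      ((integrable_coe g).sub (integrable_coe h)).locallyIntegrableOn ?_
    intro φ h1 h2 h3
    have hφ : IsTestFun L φ := ⟨h1, h2, h3⟩
    have e := (hg φ hφ).symm.trans (hh φ hφ)
    have e3 : ∫ x, φ x • (g x - h x) = ∫ x in Ioo 0 L, φ x • (g x - h x) := by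
      rw [setIntegral_eq_integral_of_forall_compl_eq_zero]
      intro x hx
      rw [image_eq_zero_of_notMem_tsupport (fun h => hx (h3 h)), zero_smul]
    have e4 : ∫ x in Ioo 0 L, φ x • (g x - h x)
        = ∫ x in Ioo 0 L, (g x * φ x - h x * φ x) :=
      integral_congr_ae (Eventually.of_forall fun x => by simp only [smul_eq_mul]; ring)
    rw [e3, e4, integral_sub (integrable_mul_cont g h1.continuous h2)
      (integrable_mul_cont h h1.continuous h2)]
    linarith
  apply Lp.ext
  filter_upwards [(ae_restrict_iff' measurableSet_Ioo).2 key] with x hx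
  linarith

/-- The Sobolev space `H¹(0, L)`. -/
def H1 (L : ℝ) : Submodule ℝ (L2 L) where
  carrier := {u | ∃ g : L2 L, HasWeakDeriv u g}
  zero_mem' := ⟨0, HasWeakDeriv.zero⟩
  add_mem' := fun ⟨g, hg⟩ ⟨h, hh⟩ => ⟨g + h, hg.add hh⟩
  smul_mem' := fun c _ ⟨g, hg⟩ => ⟨c • g, hg.smul c⟩

open scoped Classical in
/-- The weak derivative `u_x` of `u ∈ H¹(0, L)` (and `0` for `u` outside `H¹(0, L)`). -/
def wderiv {L : ℝ} (u : L2 L) : L2 L :=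
  if h : ∃ g : L2 L, HasWeakDeriv u g then h.choose else 0

theorem hasWeakDeriv_wderiv {L : ℝ} {u : L2 L} (hu : u ∈ H1 L) : HasWeakDeriv u (wderiv u) := by
  have h : ∃ g : L2 L, HasWeakDeriv u g := hu
  rw [wderiv, dif_pos h]
  exact h.choose_spec

theorem HasWeakDeriv.wderiv_eq {L : ℝ} {u g : L2 L} (h : HasWeakDeriv u g) : wderiv u = g :=
  (hasWeakDeriv_wderiv ⟨g, h⟩).unique h

theorem wderiv_add {L : ℝ} {u v : L2 L} (hu : u ∈ H1 L) (hv : v ∈ H1 L) :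
    wderiv (u + v) = wderiv u + wderiv v :=
  ((hasWeakDeriv_wderiv hu).add (hasWeakDeriv_wderiv hv)).wderiv_eq

theorem wderiv_smul {L : ℝ} (c : ℝ) {u : L2 L} (hu : u ∈ H1 L) :
    wderiv (c • u) = c • wderiv u :=
  ((hasWeakDeriv_wderiv hu).smul c).wderiv_eq

/-- The Sobolev space `H²(0, L)`. -/
def H2 (L : ℝ) : Submodule ℝ (L2 L) where
  carrier := {u | u ∈ H1 L ∧ wderiv u ∈ H1 L}
  zero_mem' := ⟨zero_mem _, by rw [HasWeakDeriv.zero.wderiv_eq]; exact zero_mem _⟩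
  add_mem' := fun ⟨h1, h2⟩ ⟨k1, k2⟩ =>
    ⟨add_mem h1 k1, by rw [wderiv_add h1 k1]; exact add_mem h2 k2⟩
  smul_mem' := fun c _ ⟨h1, h2⟩ =>
    ⟨Submodule.smul_mem _ c h1, by rw [wderiv_smul c h1]; exact Submodule.smul_mem _ c h2⟩

/-- The primitive `x ↦ ∫₀ˣ g` of `g ∈ L²(0, L)` (with `g` extended by zero). -/
def prim {L : ℝ} (g : L2 L) (x : ℝ) : ℝ := ∫ t in (0 : ℝ)..x, (Ioo 0 L).indicator g t

theorem integrable_ind {L : ℝ} (g : L2 L) : Integrable ((Ioo 0 L).indicator (g : ℝ → ℝ)) :=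
  (integrable_indicator_iff measurableSet_Ioo).2 (integrable_coe g)

theorem prim_zero {L : ℝ} (g : L2 L) : prim g 0 = 0 := by simp [prim]

theorem prim_cont {L : ℝ} (g : L2 L) : Continuous (prim g) :=
  intervalIntegral.continuous_primitive (fun _ _ => (integrable_ind g).intervalIntegrable) 0

/-- Integration by parts of the primitive against a test function. -/
theorem prim_parts {L : ℝ} (g : L2 L) {φ : ℝ → ℝ} (hφ : IsTestFun L φ) :
    ∫ x in Ioo 0 L, prim g x * deriv φ x = -∫ x in Ioo 0 L, g x * φ x := by
  rcases le_or_gt L 0 with hL | hL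
  · simp [Ioo_eq_empty_of_le hL]
  have hi : IntervalIntegrable ((Ioo 0 L).indicator (g : ℝ → ℝ)) volume 0 L :=
    (integrable_ind g).intervalIntegrable
  have h1 : AbsolutelyContinuousOnInterval (prim g) 0 L :=
    hi.absolutelyContinuousOnInterval_intervalIntegral (c := 0) (by simp)
  have h2 : AbsolutelyContinuousOnInterval φ 0 L :=
    (hφ.contDiff.of_le (by simp)).contDiffOn.absolutelyContinuousOnInterval
  have h3 := h1.integral_mul_deriv_eq_deriv_mul h2
  have hL0 : φ L = 0 :=
    image_eq_zero_of_notMem_tsupport fun h => by simpa using hφ.tsupport_subset h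
  have e1 : ∫ x in (0 : ℝ)..L, deriv (prim g) x * φ x
      = ∫ x in (0 : ℝ)..L, (Ioo 0 L).indicator (g : ℝ → ℝ) x * φ x := by
    apply intervalIntegral.integral_congr_ae
    filter_upwards [hi.ae_hasDerivAt_integral] with x hx hx2
    have hx3 : HasDerivAt (prim g) _ x := hx (uIoc_subset_uIcc hx2) 0 (by simp)
    rw [hx3.deriv]
  rw [e1, hL0, prim_zero, mul_zero, zero_mul, sub_zero, zero_sub,
    intervalIntegral.integral_of_le hL.le, intervalIntegral.integral_of_le hL.le,
    integral_Ioc_eq_integral_Ioo, integral_Ioc_eq_integral_Ioo] at h3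
  rw [h3]
  congr 1
  refine setIntegral_congr_fun measurableSet_Ioo fun x hx => ?_
  simp only [indicator_of_mem hx]

/-- A test function with vanishing integral is the derivative of a test function. -/
theorem exists_primitive_test {L : ℝ} {ψ : ℝ → ℝ} (hψ : IsTestFun L ψ)
    (h0 : ∫ x, ψ x = 0) : ∃ φ, IsTestFun L φ ∧ deriv φ = ψ := by
  have hc := hψ.contDiff.continuous
  set φ : ℝ → ℝ := fun x => ∫ t in (0 : ℝ)..x, ψ t with hφ
  have hd : ∀ x, HasDerivAt φ (ψ x) x := fun x =>
    intervalIntegral.integral_hasDerivAt_right (hc.intervalIntegrable _ _)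
      hc.stronglyMeasurable.stronglyMeasurableAtFilter hc.continuousAt
  have hde : deriv φ = ψ := funext fun x => (hd x).deriv
  rcases (tsupport ψ).eq_empty_or_nonempty with he | hne
  · have : ψ = 0 := by rwa [tsupport_eq_empty_iff] at he
    refine ⟨0, ⟨contDiff_const, HasCompactSupport.zero, ?_⟩, ?_⟩
    · simp [tsupport_eq_empty_iff.2 rfl]
    · rw [this]; ext x; simp
  have hK : IsCompact (tsupport ψ) := hψ.hasCompactSupport
  obtain ⟨a, ha, hamin⟩ := hK.exists_isLeast hne
  obtain ⟨b, hb, hbmax⟩ := hK.exists_isGreatest hne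
  have ha' := hψ.tsupport_subset ha
  have hb' := hψ.tsupport_subset hb
  have z : ∀ x, x ∉ Icc a b → ψ x = 0 := fun x hx =>
    image_eq_zero_of_notMem_tsupport fun h => hx ⟨hamin h, hbmax h⟩
  have hs : Function.support φ ⊆ Icc a b := by
    intro x hx
    by_contra hn
    apply hx
    rw [mem_Icc, not_and_or, not_le, not_le] at hn
    rcases hn with hn | hn
    · rw [hφ]
      apply intervalIntegral.integral_zero_ae
      refine Eventually.of_forall fun t ht => z t fun h => ?_
      have : t ≤ max 0 x := ht.2
      have h2 : max 0 x < a := max_lt ha'.1 hn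
      exact absurd h.1 (not_le.2 (this.trans_lt h2))
    · have e1 : ∫ t in (0 : ℝ)..x, ψ t = ∫ t, ψ t := by
        rw [intervalIntegral.integral_of_le (hb'.1.trans hn).le]
        apply setIntegral_eq_integral_of_forall_compl_eq_zero
        intro t ht
        apply z
        intro h
        exact ht ⟨ha'.1.trans_le h.1, h.2.trans hn.le⟩
      change ∫ t in (0 : ℝ)..x, ψ t = 0
      rw [e1, h0]
  have hts : tsupport φ ⊆ Icc a b := closure_minimal hs isClosed_Icc
  refine ⟨φ, ⟨?_, ?_, ?_⟩, hde⟩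
  · rw [contDiff_infty_iff_deriv]
    exact ⟨fun x => (hd x).differentiableAt, by rw [hde]; exact hψ.contDiff⟩
  · exact isCompact_Icc.of_isClosed_subset (isClosed_tsupport _) hts
  · exact hts.trans fun x hx => ⟨ha'.1.trans_le hx.1, hx.2.trans_lt hb'.2⟩

theorem exists_test_one {L : ℝ} (hL : 0 < L) : ∃ φ, IsTestFun L φ ∧ ∫ x, φ x = 1 := by
  let f : ContDiffBump (L / 2) := ⟨L / 8, L / 4, by positivity, by linarith⟩
  refine ⟨f.normed volume, ⟨f.contDiff_normed, f.hasCompactSupport_normed, ?_⟩, f.integral_normed⟩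
  rw [f.tsupport_normed_eq]
  intro x hx
  rw [Real.closedBall_eq_Icc] at hx
  have h1 := hx.1
  have h2 := hx.2
  change L / 2 - L / 4 ≤ x at h1
  change x ≤ L / 2 + L / 4 at h2
  constructor <;> linarith

/-- Every `u ∈ H¹(0, L)` coincides almost everywhere with `c + ∫₀ˣ u_x`. -/
theorem HasWeakDeriv.exists_ae_eq {L : ℝ} (hL : 0 < L) {u g : L2 L} (h : HasWeakDeriv u g) :
    ∃ c : ℝ, (u : ℝ → ℝ) =ᵐ[volume.restrict (Ioo 0 L)] fun x => c + prim g x := by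
  obtain ⟨η, hη, hη1⟩ := exists_test_one hL
  have hp : ∀ {φ : ℝ → ℝ}, Continuous φ →
      IntegrableOn (fun x => prim g x * φ x) (Ioo 0 L) := fun hφ =>
    (((prim_cont g).mul hφ).integrableOn_Icc (a := 0) (b := L)).mono_set Ioo_subset_Icc_self
  set v : ℝ → ℝ := fun x => u x - prim g x with hv
  have hvi : IntegrableOn v (Ioo 0 L) := (integrable_coe u).sub
    (((prim_cont g).integrableOn_Icc (a := 0) (b := L)).mono_set Ioo_subset_Icc_self)
  have hvm : ∀ {φ : ℝ → ℝ}, IsTestFun L φ →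
      IntegrableOn (fun x => v x * φ x) (Ioo 0 L) := fun {φ} hφ => by
    have := (integrable_mul_cont u hφ.contDiff.continuous hφ.hasCompactSupport).sub
      (hp hφ.contDiff.continuous)
    refine this.congr (Eventually.of_forall fun x => ?_)
    simp only [hv, Pi.sub_apply]; ring
  have horth : ∀ φ, IsTestFun L φ → ∫ x in Ioo 0 L, v x * deriv φ x = 0 := by
    intro φ hφ
    have e : ∫ x in Ioo 0 L, v x * deriv φ x
        = ∫ x in Ioo 0 L, (u x * deriv φ x - prim g x * deriv φ x) :=
      integral_congr_ae (Eventually.of_forall fun x => by simp only [hv]; ring)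
    rw [e, integral_sub (integrable_mul_cont u hφ.deriv_cont hφ.hasCompactSupport.deriv)
      (hp hφ.deriv_cont), h φ hφ, prim_parts g hφ, sub_self]
  set c : ℝ := ∫ x in Ioo 0 L, v x * η x with hc
  refine ⟨c, ?_⟩
  have key : ∀ᵐ x, x ∈ Ioo 0 L → (v x - c) = 0 := by
    refine isOpen_Ioo.ae_eq_zero_of_integral_contDiff_smul_eq_zero
      (hvi.sub (integrableOn_const (by simp))).locallyIntegrableOn ?_
    intro ψ h1 h2 h3
    have hψ : IsTestFun L ψ := ⟨h1, h2, h3⟩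
    have res : ∀ {f : ℝ → ℝ} (w : ℝ → ℝ), IsTestFun L f →
        ∫ x, w x * f x = ∫ x in Ioo 0 L, w x * f x := fun {f} w hf => by
      rw [setIntegral_eq_integral_of_forall_compl_eq_zero]
      intro x hx
      rw [image_eq_zero_of_notMem_tsupport (fun h => hx (hf.tsupport_subset h)), mul_zero]
    set m : ℝ := ∫ x, ψ x with hm
    have iψ := h1.continuous.integrable_of_hasCompactSupport h2 (μ := volume)
    have iη := hη.contDiff.continuous.integrable_of_hasCompactSupport hη.hasCompactSupport
      (μ := volume)
    have hθ : IsTestFun L (fun x => ψ x - m * η x) := by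
      refine ⟨h1.sub (contDiff_const.mul hη.contDiff), h2.sub hη.hasCompactSupport.mul_left, ?_⟩
      refine (tsupport_sub ψ (fun x => m * η x)).trans (union_subset h3 ?_)
      exact (tsupport_mul_subset_right).trans hη.tsupport_subset
    have hθ0 : ∫ x, (ψ x - m * η x) = 0 := by
      rw [integral_sub iψ (iη.const_mul m), integral_const_mul, hη1, mul_one, sub_self]
    obtain ⟨φ, hφ, hφd⟩ := exists_primitive_test hθ hθ0
    have o := horth φ hφ
    rw [hφd] at o
    have e1 : ∫ x in Ioo 0 L, v x * (ψ x - m * η x)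
        = ∫ x in Ioo 0 L, (v x * ψ x - m * (v x * η x)) :=
      integral_congr_ae (Eventually.of_forall fun x => by ring)
    rw [e1, integral_sub (hvm hψ) ((hvm hη).const_mul m), integral_const_mul, ← hc] at o
    have e2 : ∫ x, ψ x • (v x - c) = ∫ x, (v x - c) * ψ x :=
      integral_congr_ae (Eventually.of_forall fun x => by simp only [smul_eq_mul]; ring)
    have e3 : ∫ x in Ioo 0 L, (v x - c) * ψ x
        = ∫ x in Ioo 0 L, (v x * ψ x - c * ψ x) :=
      integral_congr_ae (Eventually.of_forall fun x => by ring)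
    have e4 := res (fun _ => 1) hψ
    simp only [one_mul] at e4
    rw [e2, res _ hψ, e3, integral_sub (hvm hψ) (iψ.integrableOn.const_mul c), integral_const_mul,
      ← e4, ← hm]
    linarith
  filter_upwards [(ae_restrict_iff' measurableSet_Ioo).2 key] with x hx
  simp only [hv] at hx
  linarith

/-- `f` is the representative of `u` that is continuous up to the boundary, on `[0, L]`. -/
def IsContRep {L : ℝ} (u : L2 L) (f : ℝ → ℝ) : Prop :=
  ContinuousOn f (Icc 0 L) ∧ (u : ℝ → ℝ) =ᵐ[volume.restrict (Ioo 0 L)] f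

open scoped Classical in
/-- The boundary value `u(x)`, `x ∈ [0, L]`: the value at `x` of the representative of `u` that is
continuous on `[0, L]` (and `0` if there is none; every `u ∈ H¹(0, L)` has one). -/
def value {L : ℝ} (x : ℝ) (u : L2 L) : ℝ :=
  if h : ∃ f : ℝ → ℝ, IsContRep u f then h.choose x else 0

theorem IsContRep.eqOn {L : ℝ} (hL : 0 < L) {u : L2 L} {f g : ℝ → ℝ} (hf : IsContRep u f)
    (hg : IsContRep u g) : EqOn f g (Icc 0 L) := by
  have h : f =ᵐ[volume.restrict (Ioo 0 L)] g := hf.2.symm.trans hg.2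
  have h1 : EqOn f g (Ioo 0 L) :=
    Measure.eqOn_open_of_ae_eq h isOpen_Ioo (hf.1.mono Ioo_subset_Icc_self)
      (hg.1.mono Ioo_subset_Icc_self)
  exact h1.of_subset_closure hf.1 hg.1 Ioo_subset_Icc_self (by rw [closure_Ioo hL.ne])

theorem IsContRep.value_eq {L : ℝ} [hL : Fact (0 < L)] {u : L2 L} {f : ℝ → ℝ}
    (hf : IsContRep u f) {x : ℝ} (hx : x ∈ Icc 0 L) : value x u = f x := by
  have h : ∃ f : ℝ → ℝ, IsContRep u f := ⟨f, hf⟩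
  rw [value, dif_pos h]
  exact h.choose_spec.eqOn hL.out hf hx

theorem exists_isContRep {L : ℝ} [hL : Fact (0 < L)] {u : L2 L} (hu : u ∈ H1 L) :
    ∃ f, IsContRep u f := by
  obtain ⟨c, hc⟩ := (hasWeakDeriv_wderiv hu).exists_ae_eq hL.out
  exact ⟨_, (continuous_const.add (prim_cont _)).continuousOn, hc⟩

theorem value_add {L : ℝ} [hL : Fact (0 < L)] {x : ℝ} (hx : x ∈ Icc 0 L) {u v : L2 L}
    (hu : u ∈ H1 L) (hv : v ∈ H1 L) : value x (u + v) = value x u + value x v := by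
  obtain ⟨f, hf⟩ := exists_isContRep hu
  obtain ⟨g, hg⟩ := exists_isContRep hv
  have : IsContRep (u + v) (f + g) :=
    ⟨hf.1.add hg.1, (Lp.coeFn_add u v).trans (hf.2.add hg.2)⟩
  rw [this.value_eq hx, hf.value_eq hx, hg.value_eq hx, Pi.add_apply]

theorem value_smul {L : ℝ} [hL : Fact (0 < L)] {x : ℝ} (hx : x ∈ Icc 0 L) (c : ℝ) {u : L2 L}
    (hu : u ∈ H1 L) : value x (c • u) = c * value x u := by
  obtain ⟨f, hf⟩ := exists_isContRep hu
  have : IsContRep (c • u) (c • f) :=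
    ⟨hf.1.const_smul c, (Lp.coeFn_smul c u).trans (hf.2.const_smul c)⟩
  rw [this.value_eq hx, hf.value_eq hx, Pi.smul_apply, smul_eq_mul]

theorem zero_mem_Icc (L : ℝ) [hL : Fact (0 < L)] : (0 : ℝ) ∈ Icc 0 L := ⟨le_rfl, hL.out.le⟩

theorem right_mem_Icc' (L : ℝ) [hL : Fact (0 < L)] : L ∈ Icc 0 L := ⟨hL.out.le, le_rfl⟩

theorem value_zero {L : ℝ} [hL : Fact (0 < L)] {x : ℝ} (hx : x ∈ Icc 0 L) :
    value x (0 : L2 L) = 0 := by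
  have := value_smul hx 0 (zero_mem (H1 L))
  rwa [zero_smul, zero_mul] at this

/-- `H¹_*(0, L) = {u ∈ H¹(0, L) ; u(0) = 0}`. -/
def H1star (L : ℝ) [Fact (0 < L)] : Submodule ℝ (L2 L) where
  carrier := {u | u ∈ H1 L ∧ value 0 u = 0}
  zero_mem' := ⟨zero_mem _, value_zero (zero_mem_Icc L)⟩
  add_mem' := fun ⟨h1, h2⟩ ⟨k1, k2⟩ =>
    ⟨add_mem h1 k1, by rw [value_add (zero_mem_Icc L) h1 k1, h2, k2, add_zero]⟩
  smul_mem' := fun c _ ⟨h1, h2⟩ =>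
    ⟨Submodule.smul_mem _ c h1, by rw [value_smul (zero_mem_Icc L) c h1, h2, mul_zero]⟩

theorem ae_eq_prim {L : ℝ} [hL : Fact (0 < L)] {u : L2 L} (hu : u ∈ H1star L) :
    (u : ℝ → ℝ) =ᵐ[volume.restrict (Ioo 0 L)] prim (wderiv u) := by
  obtain ⟨c, hc⟩ := (hasWeakDeriv_wderiv hu.1).exists_ae_eq hL.out
  have : IsContRep u (fun x => c + prim (wderiv u) x) :=
    ⟨(continuous_const.add (prim_cont _)).continuousOn, hc⟩
  have h0 := this.value_eq (zero_mem_Icc L)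
  rw [hu.2, prim_zero, add_zero] at h0
  simpa [← h0] using hc

theorem abs_prim_le {L : ℝ} (hL : 0 < L) (g : L2 L) {x : ℝ} (hx : x ∈ Icc 0 L) :
    |prim g x| ≤ √L * ‖g‖ := by
  have h1 : |prim g x| ≤ ∫ t in Ioo 0 L, |g t| := by
    unfold prim
    rw [intervalIntegral.integral_of_le hx.1]
    refine (abs_integral_le_integral_abs).trans ?_
    refine (setIntegral_le_integral (integrable_ind g).abs
      (Eventually.of_forall fun t => abs_nonneg _)).trans (le_of_eq ?_)
    rw [← integral_indicator measurableSet_Ioo]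
    congr 1
    ext t
    by_cases ht : t ∈ Ioo 0 L <;> simp [ht]
  refine h1.trans ?_
  have h2 := integral_mul_le_Lp_mul_Lq_of_nonneg (μ := volume.restrict (Ioo 0 L))
    (Real.HolderConjugate.two_two) (f := fun _ => (1 : ℝ)) (g := fun t => |g t|)
    (Eventually.of_forall fun _ => zero_le_one) (Eventually.of_forall fun _ => abs_nonneg _)
    (memLp_const 1) (by rw [show ENNReal.ofReal 2 = 2 by simp]; exact (Lp.memLp g).abs)
  have h3 : ‖g‖ = (∫ t in Ioo 0 L, |g t| ^ (2 : ℝ)) ^ (1 / (2 : ℝ)) := by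
    rw [← Real.sqrt_eq_rpow, eq_comm, Real.sqrt_eq_iff_eq_sq
      (integral_nonneg fun t => by positivity) (norm_nonneg _), ← real_inner_self_eq_norm_sq,
      L2.inner_def]
    refine integral_congr_ae (Eventually.of_forall fun t => ?_)
    simp [sq]
  simp only [one_mul, Real.one_rpow, integral_const, measureReal_restrict_apply_univ,
    Real.volume_real_Ioo_of_le hL.le, sub_zero, smul_eq_mul, mul_one] at h2
  rw [h3, Real.sqrt_eq_rpow]
  exact h2

theorem prim_memLp {L : ℝ} (g : L2 L) : MemLp (prim g) 2 (volume.restrict (Ioo 0 L)) :=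
  MemLp.of_bound (prim_cont g).aestronglyMeasurable (√L * ‖g‖) <| by
    filter_upwards [ae_restrict_mem measurableSet_Ioo] with x hx
    exact abs_prim_le (hx.1.trans hx.2) g (Ioo_subset_Icc_self hx)

/-- Poincaré inequality on `H¹_*(0, L)`. -/
theorem norm_le_wderiv {L : ℝ} [hL : Fact (0 < L)] {u : L2 L} (hu : u ∈ H1star L) :
    ‖u‖ ≤ L * ‖wderiv u‖ := by
  have hb : ∀ᵐ x ∂(volume.restrict (Ioo 0 L)), ‖u x‖ ≤ √L * ‖wderiv u‖ := by
    filter_upwards [ae_eq_prim hu, ae_restrict_mem measurableSet_Ioo] with x h1 h2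
    rw [h1, Real.norm_eq_abs]
    exact abs_prim_le hL.out _ (Ioo_subset_Icc_self h2)
  have h := Lp.norm_le_of_ae_bound (by positivity) hb
  refine h.trans (le_of_eq ?_)
  have e : (measureUnivNNReal (volume.restrict (Ioo 0 L)) : ℝ) = L := by
    rw [measureUnivNNReal, Measure.restrict_apply_univ, Real.volume_Ioo, sub_zero]
    exact ENNReal.toReal_ofReal hL.out.le
  rw [e, ← mul_assoc]
  congr 1
  rw [show ((2 : ENNReal).toReal)⁻¹ = 1 / 2 by simp, ← Real.sqrt_eq_rpow,
    Real.mul_self_sqrt hL.out.le]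

/-- Every `g ∈ L²(0, L)` is the weak derivative of some `u ∈ H¹_*(0, L)`. -/
theorem exists_wderiv_eq {L : ℝ} [hL : Fact (0 < L)] (g : L2 L) :
    ∃ u ∈ H1star L, wderiv u = g := by
  let u : L2 L := (prim_memLp g).toLp _
  have hu : (u : ℝ → ℝ) =ᵐ[volume.restrict (Ioo 0 L)] prim g := MemLp.coeFn_toLp _
  have hw : HasWeakDeriv u g := by
    intro φ hφ
    rw [← prim_parts g hφ]
    apply integral_congr_ae
    filter_upwards [hu] with x hx
    rw [hx]
  refine ⟨u, ⟨⟨g, hw⟩, ?_⟩, hw.wderiv_eq⟩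
  have : IsContRep u (prim g) := ⟨(prim_cont g).continuousOn, hu⟩
  rw [this.value_eq (zero_mem_Icc L), prim_zero]


/-- The physical constants of the laminated beam (all positive): length `L`, and coefficients
`ρ₁, ρ₂, k, b, γ`. -/
structure Params where
  L : ℝ
  ρ₁ : ℝ
  ρ₂ : ℝ
  k : ℝ
  b : ℝ
  γ : ℝ
  L_pos : 0 < L
  ρ₁_pos : 0 < ρ₁
  ρ₂_pos : 0 < ρ₂
  k_pos : 0 < k
  b_pos : 0 < b
  γ_pos : 0 < γ

instance Params.fact_L_pos (P : Params) : Fact (0 < P.L) := ⟨P.L_pos⟩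

/-- The underlying vector space of the phase space `ℋ = [H¹_*(0, L) × L²(0, L)]³ × ℝ³`; its
elements are `U = (w, Ψ₁, ξ, Ψ₂, s, Ψ₃, Ψ₄, Ψ₅, Ψ₆)`. A plain definition, so that it does not
inherit the norm of the product. -/
def Phase (P : Params) : Type :=
  (H1star P.L × L2 P.L) × (H1star P.L × L2 P.L) × (H1star P.L × L2 P.L) × (ℝ × ℝ × ℝ)

namespace Phase

variable {P : Params}

instance : AddCommGroup (Phase P) :=
  inferInstanceAs (AddCommGroup
    ((H1star P.L × L2 P.L) × (H1star P.L × L2 P.L) × (H1star P.L × L2 P.L) × (ℝ × ℝ × ℝ)))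

instance : Module ℝ (Phase P) :=
  inferInstanceAs (Module ℝ
    ((H1star P.L × L2 P.L) × (H1star P.L × L2 P.L) × (H1star P.L × L2 P.L) × (ℝ × ℝ × ℝ)))

/-- The element with the given nine components. -/
def mk (w : H1star P.L) (ψ₁ : L2 P.L) (ξ : H1star P.L) (ψ₂ : L2 P.L) (s : H1star P.L)
    (ψ₃ : L2 P.L) (ψ₄ ψ₅ ψ₆ : ℝ) : Phase P :=
  ((w, ψ₁), (ξ, ψ₂), (s, ψ₃), (ψ₄, ψ₅, ψ₆))

/-- The component `w`, as an element of `L²(0, L)` (similarly for `ξ`, `s` below). -/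
def w (U : Phase P) : L2 P.L := U.1.1
/-- The component `Ψ₁`. -/
def ψ₁ (U : Phase P) : L2 P.L := U.1.2
/-- The component `ξ`. -/
def ξ (U : Phase P) : L2 P.L := U.2.1.1
/-- The component `Ψ₂`. -/
def ψ₂ (U : Phase P) : L2 P.L := U.2.1.2
/-- The component `s`. -/
def s (U : Phase P) : L2 P.L := U.2.2.1.1
/-- The component `Ψ₃`. -/
def ψ₃ (U : Phase P) : L2 P.L := U.2.2.1.2
/-- The component `Ψ₄`. -/
def ψ₄ (U : Phase P) : ℝ := U.2.2.2.1
/-- The component `Ψ₅`. -/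
def ψ₅ (U : Phase P) : ℝ := U.2.2.2.2.1
/-- The component `Ψ₆`. -/
def ψ₆ (U : Phase P) : ℝ := U.2.2.2.2.2

theorem w_mem (U : Phase P) : U.w ∈ H1star P.L := U.1.1.2
theorem ξ_mem (U : Phase P) : U.ξ ∈ H1star P.L := U.2.1.1.2
theorem s_mem (U : Phase P) : U.s ∈ H1star P.L := U.2.2.1.1.2

theorem ext {U V : Phase P} (h1 : U.w = V.w) (h2 : U.ψ₁ = V.ψ₁) (h3 : U.ξ = V.ξ)
    (h4 : U.ψ₂ = V.ψ₂) (h5 : U.s = V.s) (h6 : U.ψ₃ = V.ψ₃) (h7 : U.ψ₄ = V.ψ₄)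
    (h8 : U.ψ₅ = V.ψ₅) (h9 : U.ψ₆ = V.ψ₆) : U = V :=
  Prod.ext (Prod.ext (Subtype.ext h1) h2) (Prod.ext (Prod.ext (Subtype.ext h3) h4)
    (Prod.ext (Prod.ext (Subtype.ext h5) h6) (Prod.ext h7 (Prod.ext h8 h9))))

@[simp] theorem mk_w (w ψ₁ ξ ψ₂ s ψ₃ ψ₄ ψ₅ ψ₆) :
    (mk (P := P) w ψ₁ ξ ψ₂ s ψ₃ ψ₄ ψ₅ ψ₆).w = w := rfl
@[simp] theorem mk_ψ₁ (w ψ₁ ξ ψ₂ s ψ₃ ψ₄ ψ₅ ψ₆) :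
    (mk (P := P) w ψ₁ ξ ψ₂ s ψ₃ ψ₄ ψ₅ ψ₆).ψ₁ = ψ₁ := rfl
@[simp] theorem mk_ξ (w ψ₁ ξ ψ₂ s ψ₃ ψ₄ ψ₅ ψ₆) :
    (mk (P := P) w ψ₁ ξ ψ₂ s ψ₃ ψ₄ ψ₅ ψ₆).ξ = ξ := rfl
@[simp] theorem mk_ψ₂ (w ψ₁ ξ ψ₂ s ψ₃ ψ₄ ψ₅ ψ₆) :
    (mk (P := P) w ψ₁ ξ ψ₂ s ψ₃ ψ₄ ψ₅ ψ₆).ψ₂ = ψ₂ := rfl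
@[simp] theorem mk_s (w ψ₁ ξ ψ₂ s ψ₃ ψ₄ ψ₅ ψ₆) :
    (mk (P := P) w ψ₁ ξ ψ₂ s ψ₃ ψ₄ ψ₅ ψ₆).s = s := rfl
@[simp] theorem mk_ψ₃ (w ψ₁ ξ ψ₂ s ψ₃ ψ₄ ψ₅ ψ₆) :
    (mk (P := P) w ψ₁ ξ ψ₂ s ψ₃ ψ₄ ψ₅ ψ₆).ψ₃ = ψ₃ := rfl
@[simp] theorem mk_ψ₄ (w ψ₁ ξ ψ₂ s ψ₃ ψ₄ ψ₅ ψ₆) :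
    (mk (P := P) w ψ₁ ξ ψ₂ s ψ₃ ψ₄ ψ₅ ψ₆).ψ₄ = ψ₄ := rfl
@[simp] theorem mk_ψ₅ (w ψ₁ ξ ψ₂ s ψ₃ ψ₄ ψ₅ ψ₆) :
    (mk (P := P) w ψ₁ ξ ψ₂ s ψ₃ ψ₄ ψ₅ ψ₆).ψ₅ = ψ₅ := rfl
@[simp] theorem mk_ψ₆ (w ψ₁ ξ ψ₂ s ψ₃ ψ₄ ψ₅ ψ₆) :
    (mk (P := P) w ψ₁ ξ ψ₂ s ψ₃ ψ₄ ψ₅ ψ₆).ψ₆ = ψ₆ := rfl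
@[simp] theorem w_add (U V : Phase P) : (U + V).w = U.w + V.w := rfl
@[simp] theorem ξ_add (U V : Phase P) : (U + V).ξ = U.ξ + V.ξ := rfl
@[simp] theorem s_add (U V : Phase P) : (U + V).s = U.s + V.s := rfl
@[simp] theorem ψ₁_add (U V : Phase P) : (U + V).ψ₁ = U.ψ₁ + V.ψ₁ := rfl
@[simp] theorem ψ₂_add (U V : Phase P) : (U + V).ψ₂ = U.ψ₂ + V.ψ₂ := rfl
@[simp] theorem ψ₃_add (U V : Phase P) : (U + V).ψ₃ = U.ψ₃ + V.ψ₃ := rfl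
@[simp] theorem ψ₄_add (U V : Phase P) : (U + V).ψ₄ = U.ψ₄ + V.ψ₄ := rfl
@[simp] theorem ψ₅_add (U V : Phase P) : (U + V).ψ₅ = U.ψ₅ + V.ψ₅ := rfl
@[simp] theorem ψ₆_add (U V : Phase P) : (U + V).ψ₆ = U.ψ₆ + V.ψ₆ := rfl
@[simp] theorem w_smul (c : ℝ) (U : Phase P) : (c • U).w = c • U.w := rfl
@[simp] theorem ξ_smul (c : ℝ) (U : Phase P) : (c • U).ξ = c • U.ξ := rfl
@[simp] theorem s_smul (c : ℝ) (U : Phase P) : (c • U).s = c • U.s := rfl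
@[simp] theorem ψ₁_smul (c : ℝ) (U : Phase P) : (c • U).ψ₁ = c • U.ψ₁ := rfl
@[simp] theorem ψ₂_smul (c : ℝ) (U : Phase P) : (c • U).ψ₂ = c • U.ψ₂ := rfl
@[simp] theorem ψ₃_smul (c : ℝ) (U : Phase P) : (c • U).ψ₃ = c • U.ψ₃ := rfl
@[simp] theorem ψ₄_smul (c : ℝ) (U : Phase P) : (c • U).ψ₄ = c * U.ψ₄ := rfl
@[simp] theorem ψ₅_smul (c : ℝ) (U : Phase P) : (c • U).ψ₅ = c * U.ψ₅ := rfl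
@[simp] theorem ψ₆_smul (c : ℝ) (U : Phase P) : (c • U).ψ₆ = c * U.ψ₆ := rfl

/-- The shear `w_x + ξ + s`. -/
def shear (U : Phase P) : L2 P.L := wderiv U.w + U.ξ + U.s

theorem shear_add (U V : Phase P) : (U + V).shear = U.shear + V.shear := by
  simp only [shear, w_add, ξ_add, s_add, wderiv_add U.w_mem.1 V.w_mem.1]; abel

theorem shear_smul (c : ℝ) (U : Phase P) : (c • U).shear = c • U.shear := by
  simp only [shear, w_smul, ξ_smul, s_smul, wderiv_smul c U.w_mem.1, smul_add]

/-- The inner product of the phase space `ℋ`. -/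
def ip (U V : Phase P) : ℝ :=
  3 * P.ρ₁ * inner ℝ U.ψ₁ V.ψ₁ + 3 * P.ρ₂ * inner ℝ U.ψ₂ V.ψ₂ + P.ρ₂ * inner ℝ U.ψ₃ V.ψ₃
    + 3 * P.b * inner ℝ (wderiv U.ξ) (wderiv V.ξ) + P.b * inner ℝ (wderiv U.s) (wderiv V.s)
    + P.γ * inner ℝ U.s V.s
    + 3 * P.k * inner ℝ U.shear V.shear
    + 3 * P.k * (U.ψ₄ * V.ψ₄) + 3 * P.b * (U.ψ₅ * V.ψ₅) + P.b * (U.ψ₆ * V.ψ₆)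

theorem ip_self (U : Phase P) : ip U U =
    3 * P.ρ₁ * ‖U.ψ₁‖ ^ 2 + 3 * P.ρ₂ * ‖U.ψ₂‖ ^ 2 + P.ρ₂ * ‖U.ψ₃‖ ^ 2
    + 3 * P.b * ‖wderiv U.ξ‖ ^ 2 + P.b * ‖wderiv U.s‖ ^ 2 + P.γ * ‖U.s‖ ^ 2
    + 3 * P.k * ‖U.shear‖ ^ 2
    + 3 * P.k * U.ψ₄ ^ 2 + 3 * P.b * U.ψ₅ ^ 2 + P.b * U.ψ₆ ^ 2 := by
  simp only [ip, real_inner_self_eq_norm_sq, sq]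

theorem eq_zero_of_wderiv {L : ℝ} [Fact (0 < L)] {u : L2 L} (hu : u ∈ H1star L)
    (h : wderiv u = 0) : u = 0 := by
  have := norm_le_wderiv hu
  rw [h, norm_zero, mul_zero] at this
  exact norm_le_zero_iff.1 this

theorem ip_definite (U : Phase P) (h : ip U U = 0) : U = 0 := by
  obtain ⟨h1, h2, h3, h4, h5⟩ := And.intro P.ρ₁_pos (And.intro P.ρ₂_pos
    (And.intro P.k_pos (And.intro P.b_pos P.γ_pos)))
  have a1 : 0 ≤ 3 * P.ρ₁ * ‖U.ψ₁‖ ^ 2 := by positivity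
  have a2 : 0 ≤ 3 * P.ρ₂ * ‖U.ψ₂‖ ^ 2 := by positivity
  have a3 : 0 ≤ P.ρ₂ * ‖U.ψ₃‖ ^ 2 := by positivity
  have a4 : 0 ≤ 3 * P.b * ‖wderiv U.ξ‖ ^ 2 := by positivity
  have a5 : 0 ≤ P.b * ‖wderiv U.s‖ ^ 2 := by positivity
  have a6 : 0 ≤ P.γ * ‖U.s‖ ^ 2 := by positivity
  have a7 : 0 ≤ 3 * P.k * ‖U.shear‖ ^ 2 := by positivity
  have a8 : 0 ≤ 3 * P.k * U.ψ₄ ^ 2 := by positivity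
  have a9 : 0 ≤ 3 * P.b * U.ψ₅ ^ 2 := by positivity
  have a10 : 0 ≤ P.b * U.ψ₆ ^ 2 := by positivity
  rw [ip_self] at h
  have z1 : 3 * P.ρ₁ * ‖U.ψ₁‖ ^ 2 = 0 := by linarith
  have z2 : 3 * P.ρ₂ * ‖U.ψ₂‖ ^ 2 = 0 := by linarith
  have z3 : P.ρ₂ * ‖U.ψ₃‖ ^ 2 = 0 := by linarith
  have z4 : 3 * P.b * ‖wderiv U.ξ‖ ^ 2 = 0 := by linarith
  have z6 : P.γ * ‖U.s‖ ^ 2 = 0 := by linarith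
  have z7 : 3 * P.k * ‖U.shear‖ ^ 2 = 0 := by linarith
  have z8 : 3 * P.k * U.ψ₄ ^ 2 = 0 := by linarith
  have z9 : 3 * P.b * U.ψ₅ ^ 2 = 0 := by linarith
  have z10 : P.b * U.ψ₆ ^ 2 = 0 := by linarith
  simp [h1.ne', h2.ne', h3.ne', h4.ne', h5.ne'] at z1 z2 z3 z4 z6 z7 z8 z9 z10
  have hξ := eq_zero_of_wderiv U.ξ_mem z4
  rw [shear, hξ, z6, add_zero, add_zero] at z7
  exact ext (eq_zero_of_wderiv U.w_mem z7) z1 hξ z2 z6 z3 z8 z9 z10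

/-- The inner product of `ℋ` is symmetric, bilinear and positive definite. -/
instance core (P : Params) : InnerProductSpace.Core ℝ (Phase P) where
  inner := ip
  conj_inner_symm U V := by
    simp only [ip, conj_trivial]
    simp only [real_inner_comm]
    ring
  re_inner_nonneg U := by
    obtain ⟨h1, h2, h3, h4, h5⟩ := And.intro P.ρ₁_pos (And.intro P.ρ₂_pos
      (And.intro P.k_pos (And.intro P.b_pos P.γ_pos)))
    change 0 ≤ ip U U
    rw [ip_self]
    positivity
  add_left U V W := by
    simp only [ip]
    simp only [shear_add, ψ₁_add, ψ₂_add, ψ₃_add, ψ₄_add, ψ₅_add, ψ₆_add, ξ_add, s_add,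
      wderiv_add U.ξ_mem.1 V.ξ_mem.1, wderiv_add U.s_mem.1 V.s_mem.1, inner_add_left _ _ (_ : L2 P.L)]
    ring
  smul_left U V c := by
    simp only [ip]
    simp only [shear_smul, ψ₁_smul, ψ₂_smul, ψ₃_smul, ψ₄_smul, ψ₅_smul, ψ₆_smul, ξ_smul, s_smul,
      wderiv_smul c U.ξ_mem.1, wderiv_smul c U.s_mem.1, real_inner_smul_left, conj_trivial]
    ring
  definite := ip_definite

instance : NormedAddCommGroup (Phase P) := (core P).toNormedAddCommGroup

instance : InnerProductSpace ℝ (Phase P) := InnerProductSpace.ofCore (core P).toCore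

theorem inner_eq (U V : Phase P) : inner ℝ U V = ip U V := rfl

theorem norm_sq_eq (U : Phase P) : ‖U‖ ^ 2 = ip U U := by
  rw [← real_inner_self_eq_norm_sq, inner_eq]

/-- The coordinates `(Ψ₁, Ψ₂, Ψ₃, ξ_x, s_x, w_x + ξ + s, Ψ₄, Ψ₅, Ψ₆)` of a phase. -/
def coord (P : Params) :
    Phase P →ₗ[ℝ] (L2 P.L × L2 P.L × L2 P.L) × (L2 P.L × L2 P.L × L2 P.L) × (ℝ × ℝ × ℝ) where
  toFun U := ((U.ψ₁, U.ψ₂, U.ψ₃), (wderiv U.ξ, wderiv U.s, U.shear), (U.ψ₄, U.ψ₅, U.ψ₆))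
  map_add' U V := by
    simp only [ψ₁_add, ψ₂_add, ψ₃_add, ψ₄_add, ψ₅_add, ψ₆_add, ξ_add, s_add, shear_add,
      wderiv_add U.ξ_mem.1 V.ξ_mem.1, wderiv_add U.s_mem.1 V.s_mem.1]
    rfl
  map_smul' c U := by
    simp only [ψ₁_smul, ψ₂_smul, ψ₃_smul, ψ₄_smul, ψ₅_smul, ψ₆_smul, ξ_smul, s_smul, shear_smul,
      wderiv_smul c U.ξ_mem.1, wderiv_smul c U.s_mem.1]
    rfl

theorem coord_surjective (P : Params) : Function.Surjective (coord P) := by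
  rintro ⟨⟨a, b, c⟩, ⟨d, e, f⟩, ⟨x, y, z⟩⟩
  obtain ⟨ξ, hξ, hξ'⟩ := exists_wderiv_eq d
  obtain ⟨s, hs, hs'⟩ := exists_wderiv_eq e
  obtain ⟨w, hw, hw'⟩ := exists_wderiv_eq (f - ξ - s)
  refine ⟨mk ⟨w, hw⟩ a ⟨ξ, hξ⟩ b ⟨s, hs⟩ c x y z, ?_⟩
  have e1 : wderiv w + ξ + s = f := by rw [hw']; abel
  change ((a, b, c), (wderiv ξ, wderiv s, wderiv w + ξ + s), (x, y, z)) = _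
  rw [hξ', hs', e1]

/-- The phase space `ℋ` is complete, that is, a Hilbert space. -/
instance : CompleteSpace (Phase P) := by
  obtain ⟨h1, h2, h3, h4, h5⟩ := And.intro P.ρ₁_pos (And.intro P.ρ₂_pos
    (And.intro P.k_pos (And.intro P.b_pos P.γ_pos)))
  have hL := P.L_pos
  -- lower bound
  obtain ⟨m, hm, m1, m2, m3, m4⟩ : ∃ m > 0, m ≤ P.ρ₁ ∧ m ≤ P.ρ₂ ∧ m ≤ P.k ∧ m ≤ P.b :=
    ⟨min (min P.ρ₁ P.ρ₂) (min P.k P.b), by positivity, by simp, by simp, by simp, by simp⟩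
  have low : ∀ U : Phase P, ‖coord P U‖ ≤ √(m⁻¹) * ‖U‖ := by
    intro U
    have hn := norm_sq_eq U
    rw [ip_self] at hn
    have a1 : 0 ≤ P.ρ₁ * ‖U.ψ₁‖ ^ 2 := by positivity
    have a2 : 0 ≤ P.ρ₂ * ‖U.ψ₂‖ ^ 2 := by positivity
    have a3 : 0 ≤ P.ρ₂ * ‖U.ψ₃‖ ^ 2 := by positivity
    have a4 : 0 ≤ P.b * ‖wderiv U.ξ‖ ^ 2 := by positivity
    have a5 : 0 ≤ P.b * ‖wderiv U.s‖ ^ 2 := by positivity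
    have a6 : 0 ≤ P.γ * ‖U.s‖ ^ 2 := by positivity
    have a7 : 0 ≤ P.k * ‖U.shear‖ ^ 2 := by positivity
    have a8 : 0 ≤ P.k * U.ψ₄ ^ 2 := by positivity
    have a9 : 0 ≤ P.b * U.ψ₅ ^ 2 := by positivity
    have a10 : 0 ≤ P.b * U.ψ₆ ^ 2 := by positivity
    have gen : ∀ {r c : ℝ}, 0 ≤ r → m ≤ c → c * r ^ 2 ≤ ‖U‖ ^ 2 → r ≤ √(m⁻¹) * ‖U‖ := by
      intro r c hr hc hle
      have q : m * r ^ 2 ≤ ‖U‖ ^ 2 :=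
        (mul_le_mul_of_nonneg_right hc (sq_nonneg r)).trans hle
      refine (pow_le_pow_iff_left₀ hr (by positivity) two_ne_zero).1 ?_
      rw [mul_pow, Real.sq_sqrt (by positivity), inv_mul_eq_div, le_div_iff₀ hm]
      linarith
    change max (max ‖U.ψ₁‖ (max ‖U.ψ₂‖ ‖U.ψ₃‖)) (max (max ‖wderiv U.ξ‖
      (max ‖wderiv U.s‖ ‖U.shear‖)) (max |U.ψ₄| (max |U.ψ₅| |U.ψ₆|))) ≤ _
    simp only [max_le_iff]
    refine ⟨⟨gen (norm_nonneg _) m1 ?_, gen (norm_nonneg _) m2 ?_, gen (norm_nonneg _) m2 ?_⟩,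
      ⟨gen (norm_nonneg _) m4 ?_, gen (norm_nonneg _) m4 ?_, gen (norm_nonneg _) m3 ?_⟩,
      gen (abs_nonneg _) m3 ?_, gen (abs_nonneg _) m4 ?_, gen (abs_nonneg _) m4 ?_⟩
    all_goals first | rw [sq_abs] | skip
    all_goals linarith
  -- upper bound
  set M : ℝ := 3 * P.ρ₁ + 3 * P.ρ₂ + P.ρ₂ + 3 * P.b + P.b + P.γ * P.L ^ 2 + 3 * P.k
    + 3 * P.k + 3 * P.b + P.b with hM
  have up : ∀ U : Phase P, ‖U‖ ≤ √M * ‖coord P U‖ := by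
    intro U
    have hn := norm_sq_eq U
    rw [ip_self] at hn
    have hN : max (max ‖U.ψ₁‖ (max ‖U.ψ₂‖ ‖U.ψ₃‖)) (max (max ‖wderiv U.ξ‖
      (max ‖wderiv U.s‖ ‖U.shear‖)) (max |U.ψ₄| (max |U.ψ₅| |U.ψ₆|))) ≤ ‖coord P U‖ := le_rfl
    set N := ‖coord P U‖
    simp only [max_le_iff] at hN
    obtain ⟨⟨b1, b2, b3⟩, ⟨b4, b5, b6⟩, b7, b8, b9⟩ := hN
    have hs : ‖U.s‖ ^ 2 ≤ P.L ^ 2 * N ^ 2 := by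
      rw [← mul_pow]
      exact pow_le_pow_left₀ (norm_nonneg _)
        ((norm_le_wderiv U.s_mem).trans (mul_le_mul_of_nonneg_left b5 hL.le)) 2
    have sqr : ∀ {c r : ℝ}, 0 ≤ c → |r| ≤ N → c * r ^ 2 ≤ c * N ^ 2 := fun hc hr =>
      mul_le_mul_of_nonneg_left (sq_le_sq.2 (hr.trans (le_abs_self N))) hc
    have c1 := sqr (c := 3 * P.ρ₁) (by positivity) ((abs_norm _).trans_le b1)
    have c2 := sqr (c := 3 * P.ρ₂) (by positivity) ((abs_norm _).trans_le b2)
    have c3 := sqr (c := P.ρ₂) (by positivity) ((abs_norm _).trans_le b3)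
    have c4 := sqr (c := 3 * P.b) (by positivity) ((abs_norm _).trans_le b4)
    have c5 := sqr (c := P.b) (by positivity) ((abs_norm _).trans_le b5)
    have c6 := sqr (c := 3 * P.k) (by positivity) ((abs_norm _).trans_le b6)
    have c7 := sqr (c := 3 * P.k) (by positivity) b7
    have c8 := sqr (c := 3 * P.b) (by positivity) b8
    have c9 := sqr (c := P.b) (by positivity) b9
    have c10 := mul_le_mul_of_nonneg_left hs h5.le
    have hM0 : 0 ≤ M := by positivity
    refine (pow_le_pow_iff_left₀ (norm_nonneg U) (by positivity) two_ne_zero).1 ?_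
    rw [mul_pow, Real.sq_sqrt hM0, hn, hM]
    linarith
  have inj : Function.Injective (coord P) := by
    rw [← LinearMap.ker_eq_bot, LinearMap.ker_eq_bot']
    intro U hU
    have := up U
    rw [hU, norm_zero, mul_zero] at this
    exact norm_le_zero_iff.1 this
  let e := LinearEquiv.ofBijective (coord P) ⟨inj, coord_surjective P⟩
  let e' := e.toContinuousLinearEquivOfBounds _ (√M) low (fun y => by
    have := up (e.symm y)
    have h : coord P (e.symm y) = y := e.apply_symm_apply y
    rwa [h] at this)
  exact (completeSpace_congr (e := e'.toEquiv) e'.isUniformEmbedding).2 inferInstance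

end Phase

/-- The domain `D(𝒜)`. -/
def beamDomain (P : Params) : Submodule ℝ (Phase P) where
  carrier := {U |
    (U.w ∈ H2 P.L ⊓ H1star P.L ∧ U.ξ ∈ H2 P.L ⊓ H1star P.L ∧ U.s ∈ H2 P.L ⊓ H1star P.L) ∧
    (U.ψ₁ ∈ H1star P.L ∧ U.ψ₂ ∈ H1star P.L ∧ U.ψ₃ ∈ H1star P.L) ∧
    U.ψ₄ = value P.L U.ψ₁ ∧ U.ψ₅ = value P.L U.ψ₂ ∧ U.ψ₆ = value P.L U.ψ₃}
  zero_mem' := by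
    have hz := value_zero (right_mem_Icc' P.L)
    exact ⟨⟨zero_mem _, zero_mem _, zero_mem _⟩, ⟨zero_mem _, zero_mem _, zero_mem _⟩,
      hz.symm, hz.symm, hz.symm⟩
  add_mem' := by
    rintro U V ⟨⟨a1, a2, a3⟩, ⟨a4, a5, a6⟩, a7, a8, a9⟩
      ⟨⟨b1, b2, b3⟩, ⟨b4, b5, b6⟩, b7, b8, b9⟩
    have hx := right_mem_Icc' P.L
    refine ⟨⟨add_mem a1 b1, add_mem a2 b2, add_mem a3 b3⟩,
      ⟨add_mem a4 b4, add_mem a5 b5, add_mem a6 b6⟩, ?_, ?_, ?_⟩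
    · rw [Phase.ψ₄_add, Phase.ψ₁_add, value_add hx a4.1 b4.1, a7, b7]
    · rw [Phase.ψ₅_add, Phase.ψ₂_add, value_add hx a5.1 b5.1, a8, b8]
    · rw [Phase.ψ₆_add, Phase.ψ₃_add, value_add hx a6.1 b6.1, a9, b9]
  smul_mem' := by
    rintro c U ⟨⟨a1, a2, a3⟩, ⟨a4, a5, a6⟩, a7, a8, a9⟩
    have hx := right_mem_Icc' P.L
    refine ⟨⟨Submodule.smul_mem _ c a1, Submodule.smul_mem _ c a2, Submodule.smul_mem _ c a3⟩,
      ⟨Submodule.smul_mem _ c a4, Submodule.smul_mem _ c a5, Submodule.smul_mem _ c a6⟩,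
      ?_, ?_, ?_⟩
    · rw [Phase.ψ₄_smul, Phase.ψ₁_smul, value_smul hx c a4.1, a7]
    · rw [Phase.ψ₅_smul, Phase.ψ₂_smul, value_smul hx c a5.1, a8]
    · rw [Phase.ψ₆_smul, Phase.ψ₃_smul, value_smul hx c a6.1, a9]

/-- The value `𝒜 U` for `U ∈ D(𝒜)`; here `U.shear` is `w_x + ξ + s`. -/
def beamFun {P : Params} (U : Phase P) (hU : U ∈ beamDomain P) : Phase P :=
  Phase.mk
    ⟨U.ψ₁, hU.2.1.1⟩
    ((1 / P.ρ₁) • (P.k • wderiv U.shear))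
    ⟨U.ψ₂, hU.2.1.2.1⟩
    ((1 / P.ρ₂) • (P.b • wderiv (wderiv U.ξ) - P.k • U.shear))
    ⟨U.ψ₃, hU.2.1.2.2⟩
    ((1 / P.ρ₂) • (P.b • wderiv (wderiv U.s) - (3 * P.k) • U.shear - P.γ • U.s))
    (-(value P.L (wderiv U.w) + value P.L U.ξ + value P.L U.s))
    (-value P.L (wderiv U.ξ))
    (-value P.L (wderiv U.s))

theorem shear_mem {P : Params} {U : Phase P} (hU : U ∈ beamDomain P) : U.shear ∈ H1 P.L :=
  add_mem (add_mem hU.1.1.1.2 hU.1.2.1.1.1) hU.1.2.2.1.1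

theorem beamFun_add {P : Params} {U V : Phase P} (hU : U ∈ beamDomain P)
    (hV : V ∈ beamDomain P) :
    beamFun (U + V) (add_mem hU hV) = beamFun U hU + beamFun V hV := by
  have hx := right_mem_Icc' P.L
  have es := Phase.shear_add U V
  have eU := shear_mem hU
  have eV := shear_mem hV
  obtain ⟨⟨⟨a1, -⟩, ⟨a2, -⟩, a3, -⟩, -, -⟩ := id hU
  obtain ⟨⟨⟨b1, -⟩, ⟨b2, -⟩, b3, -⟩, -, -⟩ := id hV
  apply Phase.ext
  · rfl
  · simp only [Phase.ψ₁_add, beamFun, Phase.mk_ψ₁]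
    rw [es, wderiv_add eU eV, smul_add, smul_add]
  · rfl
  · simp only [Phase.ψ₂_add, beamFun, Phase.mk_ψ₂, Phase.ξ_add]
    rw [es, wderiv_add a2.1 b2.1, wderiv_add a2.2 b2.2]
    simp only [smul_add, smul_sub]
    abel
  · rfl
  · simp only [Phase.ψ₃_add, beamFun, Phase.mk_ψ₃, Phase.s_add]
    rw [es, wderiv_add a3.1 b3.1, wderiv_add a3.2 b3.2]
    simp only [smul_add, smul_sub]
    abel
  · simp only [Phase.ψ₄_add, beamFun, Phase.mk_ψ₄, Phase.w_add, Phase.ξ_add, Phase.s_add]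
    rw [wderiv_add a1.1 b1.1, value_add hx a1.2 b1.2, value_add hx a2.1 b2.1,
      value_add hx a3.1 b3.1]
    ring
  · simp only [Phase.ψ₅_add, beamFun, Phase.mk_ψ₅, Phase.ξ_add]
    rw [wderiv_add a2.1 b2.1, value_add hx a2.2 b2.2]
    ring
  · simp only [Phase.ψ₆_add, beamFun, Phase.mk_ψ₆, Phase.s_add]
    rw [wderiv_add a3.1 b3.1, value_add hx a3.2 b3.2]
    ring

theorem beamFun_smul {P : Params} (c : ℝ) {U : Phase P} (hU : U ∈ beamDomain P) :
    beamFun (c • U) (Submodule.smul_mem _ c hU) = c • beamFun U hU := by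
  have hx := right_mem_Icc' P.L
  have es := Phase.shear_smul c U
  have eU := shear_mem hU
  obtain ⟨⟨⟨a1, -⟩, ⟨a2, -⟩, a3, -⟩, -, -⟩ := id hU
  have m1 : ∀ (r k : ℝ) (x : L2 P.L), r • k • c • x = c • r • k • x := fun r k x => by
    rw [smul_comm k c, smul_comm r c]
  have m2 : ∀ (r k l : ℝ) (x y : L2 P.L),
      r • (k • c • x - l • c • y) = c • r • (k • x - l • y) := fun r k l x y => by
    rw [smul_comm k c, smul_comm l c, ← smul_sub, smul_comm r c]
  have m3 : ∀ (r k l n : ℝ) (x y z : L2 P.L),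
      r • (k • c • x - l • c • y - n • c • z) = c • r • (k • x - l • y - n • z) :=
    fun r k l n x y z => by
      rw [smul_comm k c, smul_comm l c, smul_comm n c, ← smul_sub, ← smul_sub, smul_comm r c]
  apply Phase.ext
  · rw [Phase.w_smul, beamFun, beamFun, Phase.mk_w, Phase.mk_w]
    exact Phase.ψ₁_smul c U
  · rw [Phase.ψ₁_smul, beamFun, beamFun, Phase.mk_ψ₁, Phase.mk_ψ₁, es, wderiv_smul c eU, m1]
  · rw [Phase.ξ_smul, beamFun, beamFun, Phase.mk_ξ, Phase.mk_ξ]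
    exact Phase.ψ₂_smul c U
  · rw [Phase.ψ₂_smul, beamFun, beamFun, Phase.mk_ψ₂, Phase.mk_ψ₂, Phase.ξ_smul, es,
      wderiv_smul c a2.1, wderiv_smul c a2.2, m2]
  · rw [Phase.s_smul, beamFun, beamFun, Phase.mk_s, Phase.mk_s]
    exact Phase.ψ₃_smul c U
  · rw [Phase.ψ₃_smul, beamFun, beamFun, Phase.mk_ψ₃, Phase.mk_ψ₃, Phase.s_smul, es,
      wderiv_smul c a3.1, wderiv_smul c a3.2, m3]
  · simp only [Phase.ψ₄_smul, beamFun, Phase.mk_ψ₄, Phase.w_smul, Phase.ξ_smul, Phase.s_smul]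
    rw [wderiv_smul c a1.1, value_smul hx c a1.2, value_smul hx c a2.1, value_smul hx c a3.1]
    ring
  · simp only [Phase.ψ₅_smul, beamFun, Phase.mk_ψ₅, Phase.ξ_smul]
    rw [wderiv_smul c a2.1, value_smul hx c a2.2]
    ring
  · simp only [Phase.ψ₆_smul, beamFun, Phase.mk_ψ₆, Phase.s_smul]
    rw [wderiv_smul c a3.1, value_smul hx c a3.2]
    ring

/-- The unbounded operator `(𝒜, D(𝒜))` on `ℋ`. -/
def beamOp (P : Params) : Phase P →ₗ.[ℝ] Phase P where
  domain := beamDomain P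
  toFun :=
    { toFun := fun U => beamFun U.1 U.2
      map_add' := fun U V => beamFun_add U.2 V.2
      map_smul' := fun c U => beamFun_smul c U.2 }

/-- A densely defined operator `A` on a real Hilbert space is skew-adjoint if `A* = -A`, including
equality of domains. -/
def IsSkewAdjoint {H : Type*} [NormedAddCommGroup H] [InnerProductSpace ℝ H] [CompleteSpace H]
    (A : H →ₗ.[ℝ] H) : Prop :=
  Dense (A.domain : Set H) ∧ A.adjoint = -A

/-- A `C₀`-group (strongly continuous group) of bounded linear operators. -/
structure C0Group (X : Type*) [NormedAddCommGroup X] [NormedSpace ℝ X] where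
  S : ℝ → X →L[ℝ] X
  map_zero : S 0 = ContinuousLinearMap.id ℝ X
  map_add : ∀ t r : ℝ, S (t + r) = (S t).comp (S r)
  continuous_orbit : ∀ x : X, Continuous fun t : ℝ => S t x

namespace C0Group

variable {X : Type*} [NormedAddCommGroup X] [NormedSpace ℝ X]

/-- `A` is the infinitesimal generator of the group: `x ∈ D(A)` and `A x = y` if and only if
`(S(t)x - x)/t → y` as `t → 0`. -/
def IsGenerator (G : C0Group X) (A : X →ₗ.[ℝ] X) : Prop :=
  ∀ x y : X, (x, y) ∈ A.graph ↔
    Tendsto (fun t : ℝ => t⁻¹ • (G.S t x - x)) (𝓝[≠] 0) (𝓝 y)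

/-- Every operator `S(t)` preserves the norm. -/
def IsIsometric (G : C0Group X) : Prop := ∀ t : ℝ, Isometry (G.S t)

end C0Group

end LaminatedBeam

end

/-! Everything follows from two properties of the beam operator `A`: it is skew-symmetric
(`beamOp_skew`) and surjective (`beamOp_surjective`).

On a real Hilbert space these two suffice. If `⟨A x, y⟩ = -⟨x, z⟩` for all `x` in the domain, choose
`u` with `A u = z`; then `y - u` is orthogonal to the range of `A`, so `y = u`. This maximality
(`mem_graph_of_formal`) gives `A* = -A` (`isSkewAdjoint_of_surjective`). Moreover `A` has an
everywhere defined inverse `K`, which is bounded, skew and of dense range. The group is then built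
from `K` alone (`IsSkew.exists_group`): the bounded skew operators `-K (ε - K²)⁻¹` commute with each
other and tend to `K⁻¹` on the range of `K³`, so their exponentials, which are isometries, converge
strongly to an isometric group with generator extending `K⁻¹ = A`. Maximality excludes a proper
extension (`exists_group_of_surjective`).

For the beam, skew-symmetry is integration by parts: the boundary terms at `L` are cancelled by the
components `Ψ₄, Ψ₅, Ψ₆`. Surjectivity holds because `A U = F` is triangular: the velocities are read
off from `F`, the shear and `ξ_x` are primitives, `s` solves a scalar elliptic problem by Riesz
representation, and `w` is recovered from the shear. -/

namespace LaminatedBeam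

/-! ### Exponentials of bounded skew operators. -/

section SkewAdjoint

variable {H : Type*} [NormedAddCommGroup H] [InnerProductSpace ℝ H]

/-- A bounded operator `B` on a real inner product space is skew if `⟨B x, y⟩ = -⟨x, B y⟩`. -/
def IsSkew (B : H →L[ℝ] H) : Prop := ∀ x y, inner ℝ (B x) y = -inner ℝ x (B y)

theorem IsSkew.inner_self {B : H →L[ℝ] H} (hB : IsSkew B) (x : H) : inner ℝ (B x) x = 0 := by
  have := hB x x
  rw [real_inner_comm (B x) x] at this
  linarith

theorem IsSkew.sub {B C : H →L[ℝ] H} (hB : IsSkew B) (hC : IsSkew C) : IsSkew (B - C) :=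
  fun x y => by
    simp only [sub_apply, inner_sub_left, inner_sub_right, hB x y, hC x y]
    ring

variable [CompleteSpace H]

theorem hasDerivAt_exp_smul_apply (B : H →L[ℝ] H) (x : H) (t : ℝ) :
    HasDerivAt (fun r : ℝ => NormedSpace.exp (r • B) x) (NormedSpace.exp (t • B) (B x)) t :=
  (ContinuousLinearMap.apply ℝ H x).hasFDerivAt.comp_hasDerivAt t (hasDerivAt_exp_smul_const B t)

/-- The derivative of the squared norm is `2 ⟨y, B y⟩ = 0` with `y = exp (r B) x`. -/
theorem IsSkew.norm_exp_apply {B : H →L[ℝ] H} (hB : IsSkew B) (t : ℝ) (x : H) :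
    ‖NormedSpace.exp (t • B) x‖ = ‖x‖ := by
  have hd : ∀ r : ℝ, HasDerivAt (fun r : ℝ => ‖NormedSpace.exp (r • B) x‖ ^ 2) 0 r := by
    intro r
    have h := ((ContinuousLinearMap.apply ℝ H x).hasFDerivAt.comp_hasDerivAt r
      (hasDerivAt_exp_smul_const' B r)).norm_sq
    simp only [Function.comp_apply, ContinuousLinearMap.apply_apply,
      mul_apply_eq_comp] at h
    rwa [real_inner_comm, hB.inner_self, mul_zero] at h
  have := is_const_of_deriv_eq_zero (fun r => (hd r).differentiableAt) (fun r => (hd r).deriv) t 0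
  simpa using this

/-- Mean value inequality: the derivative `exp (r B) (B x)` has constant norm `‖B x‖`. -/
theorem IsSkew.norm_exp_apply_sub_le {B : H →L[ℝ] H} (hB : IsSkew B) (t : ℝ) (x : H) :
    ‖NormedSpace.exp (t • B) x - x‖ ≤ ‖B x‖ * |t| := by
  have := convex_univ.norm_image_sub_le_of_norm_hasDerivWithin_le (s := univ) (x := (0 : ℝ))
    (y := t) (C := ‖B x‖) (f := fun r : ℝ => NormedSpace.exp (r • B) x)
    (fun r _ => (hasDerivAt_exp_smul_apply B x r).hasDerivWithinAt)
    (fun r _ => (hB.norm_exp_apply r (B x)).le) trivial trivial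
  simpa using this

/-- The derivative in `r` is `exp (r B) (B x) - B x`, which the preceding estimate, applied to `B
x`, bounds by `‖B (B x)‖ |t|` between `0` and `t`. -/
theorem IsSkew.norm_exp_apply_sub_sub_le {B : H →L[ℝ] H} (hB : IsSkew B) (t : ℝ) (x : H) :
    ‖NormedSpace.exp (t • B) x - x - t • B x‖ ≤ ‖B (B x)‖ * |t| * |t| := by
  have hd : ∀ r ∈ uIcc 0 t, HasDerivWithinAt (fun r : ℝ => NormedSpace.exp (r • B) x - r • B x)
      (NormedSpace.exp (r • B) (B x) - B x) (uIcc 0 t) r := fun r _ => by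
    have h := (hasDerivAt_id r).smul_const (B x)
    rw [one_smul] at h
    exact ((hasDerivAt_exp_smul_apply B x r).sub h).hasDerivWithinAt
  have := (convex_uIcc 0 t).norm_image_sub_le_of_norm_hasDerivWithin_le (C := ‖B (B x)‖ * |t|) hd
    (fun r hr => (hB.norm_exp_apply_sub_le r (B x)).trans <| by
      refine mul_le_mul_of_nonneg_left ?_ (norm_nonneg _)
      simpa only [sub_zero] using abs_sub_left_of_mem_uIcc hr) left_mem_uIcc right_mem_uIcc
  simpa [sub_right_comm] using this

/-- By commutativity `exp (t B) = exp (t C) exp (t (B - C))`, and `exp (t C)` is an isometry.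
Pointwise convergence of generators thus becomes pointwise convergence of exponentials. -/
theorem IsSkew.norm_exp_apply_sub_exp_apply_le {B C : H →L[ℝ] H} (hB : IsSkew B) (hC : IsSkew C)
    (h : Commute B C) (t : ℝ) (x : H) :
    ‖NormedSpace.exp (t • B) x - NormedSpace.exp (t • C) x‖ ≤ ‖B x - C x‖ * |t| := by
  have e : t • B = t • C + t • (B - C) := by rw [← smul_add]; simp
  have hc : Commute (t • C) (t • (B - C)) :=
    ((h.symm.sub_right (Commute.refl C)).smul_right t).smul_left t
  let _ := NormedAlgebra.restrictScalars ℚ ℝ (H →L[ℝ] H)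
  rw [e, NormedSpace.exp_add_of_commute hc, mul_apply_eq_comp, ← map_sub,
    hC.norm_exp_apply]
  exact (hB.sub hC).norm_exp_apply_sub_le t x

/-! ### Yosida approximation of the inverse of a skew operator. -/

/-- The Yosida-type approximation `-K (ε - K²)⁻¹` of the inverse of the skew operator `K`. -/
noncomputable def yosida (K : H →L[ℝ] H) (ε : ℝ) : H →L[ℝ] H :=
  -(K * Ring.inverse (ε • 1 - K * K))

/-- Coercivity: skewness turns `-⟨K² x, x⟩` into `‖K x‖²`, so the quadratic form is at least `ε
‖x‖²`. -/
theorem IsSkew.isUnit {K : H →L[ℝ] H} (hK : IsSkew K) {ε : ℝ} (hε : 0 < ε) :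
    IsUnit (ε • 1 - K * K) := by
  refine ContinuousLinearMap.isUnit_of_forall_le_norm_inner_map _ (c := ε.toNNReal)
    (by simpa) fun x => ?_
  have e : inner ℝ ((ε • 1 - K * K) x) x = ε * ‖x‖ ^ 2 + ‖K x‖ ^ 2 := by
    simp [inner_sub_left, real_inner_smul_left, hK (K x) x]
  rw [e, Real.norm_eq_abs, abs_of_nonneg (by positivity), Real.coe_toNNReal _ hε.le]
  nlinarith [sq_nonneg ‖K x‖]

theorem IsSkew.inverse_apply {K : H →L[ℝ] H} (hK : IsSkew K) {ε : ℝ} (hε : 0 < ε) (x : H) :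
    ε • Ring.inverse (ε • 1 - K * K) x - K (K (Ring.inverse (ε • 1 - K * K) x)) = x := by
  have := DFunLike.congr_fun (Ring.mul_inverse_cancel _ (hK.isUnit hε)) x
  simpa using this

theorem commute_inverse_of_isUnit {R : Type*} [Ring R] {a b : R} (h : Commute a b)
    (hb : IsUnit b) : Commute a (Ring.inverse b) := by
  obtain ⟨u, rfl⟩ := hb
  rw [Ring.inverse_unit]
  exact h.units_inv_right

theorem IsSkew.commute_inverse {K C : H →L[ℝ] H} (hK : IsSkew K) (h : Commute C K) {ε : ℝ}
    (hε : 0 < ε) : Commute C (Ring.inverse (ε • 1 - K * K)) :=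
  commute_inverse_of_isUnit
    (((Commute.one_right C).smul_right ε).sub_right (h.mul_right h)) (hK.isUnit hε)

theorem IsSkew.commute_yosida_right {K C : H →L[ℝ] H} (hK : IsSkew K) (h : Commute C K) {ε : ℝ}
    (hε : 0 < ε) : Commute C (yosida K ε) :=
  (h.mul_right (hK.commute_inverse h hε)).neg_right

theorem IsSkew.commute_yosida {K : H →L[ℝ] H} (hK : IsSkew K) {ε δ : ℝ}
    (hε : 0 < ε) (hδ : 0 < δ) : Commute (yosida K ε) (yosida K δ) :=
  hK.commute_yosida_right (hK.commute_yosida_right (Commute.refl K) hε).symm hδ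

theorem IsSkew.inner_inverse {K : H →L[ℝ] H} (hK : IsSkew K) {ε : ℝ} (hε : 0 < ε) (x y : H) :
    inner ℝ (Ring.inverse (ε • 1 - K * K) x) y = inner ℝ x (Ring.inverse (ε • 1 - K * K) y) := by
  have hx := hK.inverse_apply hε x
  have hy := hK.inverse_apply hε y
  set a := Ring.inverse (ε • 1 - K * K) x
  set b := Ring.inverse (ε • 1 - K * K) y
  rw [← hx, ← hy]
  simp only [inner_sub_left, inner_sub_right, real_inner_smul_left, real_inner_smul_right,
    hK (K a) b, ← neg_eq_iff_eq_neg.2 (hK a (K b))]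

/-- A skew operator times a symmetric operator commuting with it is skew. -/
theorem IsSkew.yosida {K : H →L[ℝ] H} (hK : IsSkew K) {ε : ℝ} (hε : 0 < ε) :
    IsSkew (yosida K ε) := fun x y => by
  have hc := DFunLike.congr_fun (hK.commute_inverse (Commute.refl K) hε) y
  simp only [mul_apply_eq_comp] at hc
  simp only [LaminatedBeam.yosida, neg_apply, mul_apply_eq_comp, inner_neg_left,
    inner_neg_right, hK _ y, hK.inner_inverse hε, hc]

/-- With `a = (ε - K²)⁻¹ x`, pairing `x` with `a` gives `ε ‖a‖² ≤ ⟨x, a⟩ ≤ ‖x‖ ‖a‖`. -/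
theorem IsSkew.norm_inverse_le {K : H →L[ℝ] H} (hK : IsSkew K) {ε : ℝ} (hε : 0 < ε) (x : H) :
    ‖ε • Ring.inverse (ε • 1 - K * K) x‖ ≤ ‖x‖ := by
  have hx := hK.inverse_apply hε x
  set a := Ring.inverse (ε • 1 - K * K) x
  have h1 : inner ℝ x a = ε * ‖a‖ ^ 2 + ‖K a‖ ^ 2 := by
    rw [← hx, inner_sub_left, real_inner_smul_left, hK (K a) a, real_inner_self_eq_norm_sq,
      real_inner_self_eq_norm_sq]
    ring
  have h2 := real_inner_le_norm x a
  rw [norm_smul, Real.norm_eq_abs, abs_of_pos hε]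
  rcases (norm_nonneg a).eq_or_lt with h0 | h0
  · rw [← h0, mul_zero]; exact norm_nonneg x
  · refine le_of_mul_le_mul_right ?_ h0
    nlinarith [sq_nonneg ‖K a‖]

/-- `B K x = x - ε T⁻¹ x`. -/
theorem IsSkew.yosida_apply {K : H →L[ℝ] H} (hK : IsSkew K) {ε : ℝ} (hε : 0 < ε) (x : H) :
    LaminatedBeam.yosida K ε (K x) = x - ε • Ring.inverse (ε • 1 - K * K) x := by
  have hc := DFunLike.congr_fun (hK.commute_inverse (Commute.refl K) hε) x
  simp only [mul_apply_eq_comp] at hc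
  have hx := hK.inverse_apply hε x
  simp only [LaminatedBeam.yosida, neg_apply, mul_apply_eq_comp, ← hc]
  nth_rw 2 [← hx]
  abel

/-- The point is uniformity in `ε`: on the range of `K` the approximations stay bounded, although
their operator norms may blow up. -/
theorem IsSkew.norm_yosida_apply_le {K : H →L[ℝ] H} (hK : IsSkew K) {ε : ℝ} (hε : 0 < ε) (x : H) :
    ‖LaminatedBeam.yosida K ε (K x)‖ ≤ 2 * ‖x‖ := by
  rw [hK.yosida_apply hε]
  linarith [norm_sub_le x (ε • Ring.inverse (ε • 1 - K * K) x), hK.norm_inverse_le hε x]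

/-- This is convergence to `K⁻¹` on the range of `K³`, at rate `O(ε)`. -/
theorem IsSkew.norm_yosida_apply_sub_le {K : H →L[ℝ] H} (hK : IsSkew K) {ε : ℝ} (hε : 0 < ε)
    (x : H) : ‖LaminatedBeam.yosida K ε (K (K (K x))) - K (K x)‖ ≤ 2 * ‖x‖ * ε := by
  have hc := DFunLike.congr_fun
    (hK.commute_inverse ((Commute.refl K).mul_left (Commute.refl K)) hε) x
  simp only [mul_apply_eq_comp] at hc
  have hx := hK.inverse_apply hε x
  -- With `T = ε - K²`, the difference is `-ε T⁻¹ K² x = -ε K² T⁻¹ x`, and `K² T⁻¹ x = ε T⁻¹ x - x`.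
  have e : LaminatedBeam.yosida K ε (K (K (K x))) - K (K x)
      = ε • (x - ε • Ring.inverse (ε • 1 - K * K) x) := by
    rw [hK.yosida_apply hε, ← hc, eq_sub_of_add_eq' (sub_eq_iff_eq_add.1 hx).symm]
    module
  rw [e, norm_smul, Real.norm_eq_abs, abs_of_pos hε, mul_comm]
  gcongr
  linarith [norm_sub_le x (ε • Ring.inverse (ε • 1 - K * K) x), hK.norm_inverse_le hε x]

end SkewAdjoint

/-! ### The isometric group as a strong limit of exponentials. -/

section Group

variable {H : Type*} [NormedAddCommGroup H] [InnerProductSpace ℝ H]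

/-- A sequence of norm-preserving operators that is pointwise Cauchy on a dense set is pointwise
Cauchy. -/
theorem cauchySeq_of_dense {E : ℕ → H →L[ℝ] H} (hE : ∀ n x, ‖E n x‖ = ‖x‖) {D : Set H}
    (hD : Dense D) (h : ∀ x ∈ D, CauchySeq fun n => E n x) (x : H) :
    CauchySeq fun n => E n x := by
  rw [Metric.cauchySeq_iff]
  intro ε hε
  obtain ⟨y, hy, hxy⟩ := Metric.dense_iff.1 hD x (ε / 3) (by positivity)
  obtain ⟨N, hN⟩ := Metric.cauchySeq_iff.1 (h _ hxy) (ε / 3) (by positivity)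
  rw [Metric.mem_ball, dist_eq_norm] at hy
  refine ⟨N, fun m hm n hn => ?_⟩
  have h1 := hN m hm n hn
  have h2 : dist (E m x) (E m y) = ‖y - x‖ := by
    rw [dist_eq_norm, ← map_sub, hE, norm_sub_rev]
  have h3 : dist (E n y) (E n x) = ‖y - x‖ := by rw [dist_eq_norm, ← map_sub, hE]
  linarith [dist_triangle4 (E m x) (E m y) (E n y) (E n x)]

theorem denseRange_comp_comp {K : H →L[ℝ] H} (hd : DenseRange K) :
    DenseRange (fun x => K (K (K x))) :=
  hd.comp (hd.comp hd K.continuous) (K.continuous)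

/-- The exponentials of the approximations `yosida K (1 / (n + 1))`. -/
noncomputable def yosidaExp (K : H →L[ℝ] H) (n : ℕ) (t : ℝ) : H →L[ℝ] H :=
  NormedSpace.exp (t • yosida K (1 / ((n : ℝ) + 1)))

theorem yosidaExp_zero (K : H →L[ℝ] H) (n : ℕ) (x : H) : yosidaExp K n 0 x = x := by
  simp [yosidaExp]

variable {A : H →ₗ.[ℝ] H}

/-- A surjective skew-symmetric operator is maximal: every formal value of `-A*` is a value
of `A`. -/
theorem mem_graph_of_formal
    (hskew : ∀ x y : A.domain, inner ℝ (A x) (y : H) = -inner ℝ (x : H) (A y))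
    (hsurj : ∀ f, ∃ x : A.domain, A x = f) {y z : H}
    (h : ∀ x : A.domain, inner ℝ (A x) y = -inner ℝ (x : H) z) :
    ∃ hy : y ∈ A.domain, A ⟨y, hy⟩ = z := by
  obtain ⟨u, hu⟩ := hsurj z
  -- Every vector has the form `A x`, so `y` and `u` can be compared by testing against the range of
  -- `A`.
  have e : y = u := by
    refine ext_inner_left ℝ fun v => ?_
    obtain ⟨x, rfl⟩ := hsurj v
    rw [h, hskew, hu]
  subst e
  exact ⟨u.2, hu⟩

variable [CompleteSpace H]

theorem IsSkew.norm_yosidaExp {K : H →L[ℝ] H} (hK : IsSkew K) (n : ℕ) (t : ℝ) (x : H) :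
    ‖yosidaExp K n t x‖ = ‖x‖ :=
  (hK.yosida Nat.one_div_pos_of_nat).norm_exp_apply t x

theorem yosidaExp_add (K : H →L[ℝ] H) (n : ℕ) (t r : ℝ) (x : H) :
    yosidaExp K n (t + r) x = yosidaExp K n t (yosidaExp K n r x) := by
  let _ := NormedAlgebra.restrictScalars ℚ ℝ (H →L[ℝ] H)
  rw [yosidaExp, add_smul, NormedSpace.exp_add_of_commute
    (((Commute.refl _).smul_right r).smul_left t)]
  rfl

theorem IsSkew.tendsto_yosida {K : H →L[ℝ] H} (hK : IsSkew K) (z : H) :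
    Tendsto (fun n : ℕ => LaminatedBeam.yosida K (1 / ((n : ℝ) + 1)) (K (K (K z)))) atTop
      (𝓝 (K (K z))) := by
  rw [tendsto_iff_norm_sub_tendsto_zero]
  refine squeeze_zero (fun _ => norm_nonneg _)
    (fun n => hK.norm_yosida_apply_sub_le Nat.one_div_pos_of_nat z) ?_
  simpa using (tendsto_one_div_add_atTop_nhds_zero_nat (𝕜 := ℝ)).const_mul (2 * ‖z‖)

theorem IsSkew.cauchySeq_yosidaExp {K : H →L[ℝ] H} (hK : IsSkew K) (hd : DenseRange K) (t : ℝ)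
    (x : H) : CauchySeq fun n => yosidaExp K n t x := by
  refine cauchySeq_of_dense (fun n => hK.norm_yosidaExp n t) (denseRange_comp_comp hd) ?_ x
  rintro _ ⟨z, rfl⟩
  rw [Metric.cauchySeq_iff]
  intro ε hε
  -- The tolerance absorbs the factor `|t|` of the comparison estimate; the added `1` covers `t =
  -- 0`.
  obtain ⟨N, hN⟩ := Metric.cauchySeq_iff.1 (hK.tendsto_yosida z).cauchySeq (ε / (|t| + 1))
    (by positivity)
  refine ⟨N, fun m hm n hn => ?_⟩
  have h1 := hN m hm n hn
  rw [dist_eq_norm, lt_div_iff₀ (by positivity)] at h1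
  rw [dist_eq_norm]
  refine lt_of_le_of_lt ((hK.yosida Nat.one_div_pos_of_nat).norm_exp_apply_sub_exp_apply_le
    (hK.yosida Nat.one_div_pos_of_nat)
    (hK.commute_yosida Nat.one_div_pos_of_nat Nat.one_div_pos_of_nat) t _) (lt_of_le_of_lt ?_ h1)
  gcongr
  linarith

/-- The limit condition says that the generator extends `K⁻¹`; equality is proved later by
maximality. -/
theorem IsSkew.exists_group {K : H →L[ℝ] H} (hK : IsSkew K) (hd : DenseRange K) :
    ∃ G : C0Group H, G.IsIsometric ∧
      ∀ x, Tendsto (fun t : ℝ => t⁻¹ • (G.S t (K x) - K x)) (𝓝[≠] 0) (𝓝 x) := by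
  choose f hf using fun (t : ℝ) (x : H) =>
    cauchySeq_tendsto_of_complete (hK.cauchySeq_yosidaExp hd t x)
  let S : ℝ → H →L[ℝ] H := fun t =>
    continuousLinearMapOfTendsto (fun n => yosidaExp K n t) (f := f t) (tendsto_pi_nhds.2 (hf t))
  have hS : ∀ t x, Tendsto (fun n => yosidaExp K n t x) atTop (𝓝 (S t x)) := hf
  have hn : ∀ t x, ‖S t x‖ = ‖x‖ := fun t x =>
    tendsto_nhds_unique ((hS t x).norm) (by simp [hK.norm_yosidaExp])
  have h0 : ∀ x, S 0 x = x := fun x =>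
    tendsto_nhds_unique (hS 0 x) (by simp [yosidaExp_zero])
  have hadd : ∀ t r x, S (t + r) x = S t (S r x) := by
    intro t r x
    refine tendsto_nhds_unique (hS _ x) ?_
    -- Strong limits multiply here because the approximants preserve the norm.
    have h1 : Tendsto (fun n => yosidaExp K n t (yosidaExp K n r x - S r x)) atTop (𝓝 0) := by
      rw [tendsto_zero_iff_norm_tendsto_zero]
      simp only [hK.norm_yosidaExp]
      exact tendsto_iff_norm_sub_tendsto_zero.1 (hS r x)
    have h2 := h1.add (hS t (S r x))
    simpa [yosidaExp_add] using h2
  have hlip : ∀ t x, ‖S t (K x) - K x‖ ≤ 2 * ‖x‖ * |t| := by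
    intro t x
    refine le_of_tendsto ((hS t (K x)).sub_const (K x)).norm (Eventually.of_forall fun n => ?_)
    refine ((hK.yosida Nat.one_div_pos_of_nat).norm_exp_apply_sub_le t _).trans ?_
    gcongr
    exact hK.norm_yosida_apply_le Nat.one_div_pos_of_nat x
  -- The second-order estimate survives the limit because, for the approximation `B`, `B B K³ z = B
  -- K (B K (K z))`: two uses of the uniform bound give `2 * 2 * ‖K z‖`.
  have htay : ∀ t z, ‖S t (K (K (K z))) - K (K (K z)) - t • K (K z)‖ ≤ 4 * ‖K z‖ * |t| * |t| := by
    intro t z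
    refine le_of_tendsto (((hS t _).sub_const _).sub ((hK.tendsto_yosida z).const_smul t)).norm
      (Eventually.of_forall fun n => ?_)
    refine ((hK.yosida Nat.one_div_pos_of_nat).norm_exp_apply_sub_sub_le t _).trans ?_
    have hc := DFunLike.congr_fun (hK.commute_yosida_right (Commute.refl K)
      (Nat.one_div_pos_of_nat (n := n))) (K (K z))
    simp only [mul_apply_eq_comp] at hc
    rw [← hc]
    gcongr
    refine (hK.norm_yosida_apply_le Nat.one_div_pos_of_nat _).trans ?_
    linarith [hK.norm_yosida_apply_le (Nat.one_div_pos_of_nat (α := ℝ) (n := n)) (K z)]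
  have hder : ∀ x, Tendsto (fun t : ℝ => t⁻¹ • (S t (K x) - K x)) (𝓝[≠] 0) (𝓝 x) := by
    intro x
    rw [Metric.tendsto_nhds]
    intro ε hε
    -- Approximate `x` by `K² z`: the Taylor estimate handles `K³ z`, the Lipschitz estimate handles
    -- `K (K² z - x)`. The error `‖K² z - x‖` is counted three times, hence `ε / 6` beside the `ε /
    -- 2` below.
    obtain ⟨_, hy, z, rfl⟩ := Metric.dense_iff.1 (hd.comp hd K.continuous) x (ε / 6) (by positivity)
    simp only [Function.comp_apply, Metric.mem_ball, dist_eq_norm] at hy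
    have hev : ∀ᶠ t : ℝ in 𝓝[≠] 0, 4 * ‖K z‖ * |t| < ε / 2 := by
      have : Tendsto (fun t : ℝ => 4 * ‖K z‖ * |t|) (𝓝 0) (𝓝 (4 * ‖K z‖ * |(0 : ℝ)|)) :=
        (continuous_const.mul continuous_abs).tendsto 0
      rw [abs_zero, mul_zero] at this
      exact nhdsWithin_le_nhds (this.eventually_lt_const (by positivity))
    filter_upwards [hev, self_mem_nhdsWithin] with t ht ht0
    have ht0 : 0 < |t| := abs_pos.2 ht0
    have e : t⁻¹ • (S t (K x) - K x) - x
        = t⁻¹ • ((S t (K (K (K z))) - K (K (K z)) - t • K (K z))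
          - ((S t (K (K (K z) - x)) - K (K (K z) - x)))) + (K (K z) - x) := by
      simp only [map_sub, smul_sub, inv_smul_smul₀ (abs_pos.1 ht0)]
      abel
    have h1 := htay t z
    have h2 := hlip t (K (K z) - x)
    rw [dist_eq_norm, e]
    refine (norm_add_le _ _).trans_lt ?_
    rw [norm_smul, norm_inv, Real.norm_eq_abs]
    have h3 : |t|⁻¹ * ‖(S t (K (K (K z))) - K (K (K z)) - t • K (K z))
          - ((S t (K (K (K z) - x)) - K (K (K z) - x)))‖
        ≤ 4 * ‖K z‖ * |t| + 2 * ‖K (K z) - x‖ := by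
      rw [inv_mul_le_iff₀ ht0]
      refine (norm_sub_le _ _).trans ?_
      linarith
    linarith
  have hcont0 : ∀ x, Tendsto (fun t => S t x) (𝓝 0) (𝓝 x) := by
    intro x
    rw [Metric.tendsto_nhds]
    intro ε hε
    obtain ⟨_, hy, z, rfl⟩ := Metric.dense_iff.1 hd x (ε / 3) (by positivity)
    rw [Metric.mem_ball, dist_eq_norm] at hy
    have hev : ∀ᶠ t : ℝ in 𝓝 0, 2 * ‖z‖ * |t| < ε / 3 := by
      have : Tendsto (fun t : ℝ => 2 * ‖z‖ * |t|) (𝓝 0) (𝓝 (2 * ‖z‖ * |(0 : ℝ)|)) :=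
        (continuous_const.mul continuous_abs).tendsto 0
      rw [abs_zero, mul_zero] at this
      exact this.eventually_lt_const (by positivity)
    filter_upwards [hev] with t ht
    have h1 := hlip t z
    have h2 : dist (S t x) (S t (K z)) = ‖K z - x‖ := by
      rw [dist_eq_norm, ← map_sub, hn, norm_sub_rev]
    rw [← dist_eq_norm] at h1
    have h3 : dist (K z) x = ‖K z - x‖ := dist_eq_norm _ _
    linarith [dist_triangle4 (S t x) (S t (K z)) (K z) x]
  refine ⟨⟨S, ContinuousLinearMap.ext h0, fun t r => ContinuousLinearMap.ext (hadd t r), ?_⟩,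
    fun t => AddMonoidHomClass.isometry_of_norm _ (hn t), hder⟩
  intro x
  rw [continuous_iff_continuousAt]
  intro t
  -- The group law transports strong continuity at `0` to every `t`.
  have h1 : Tendsto (fun r : ℝ => S t (S (r - t) x)) (𝓝 t) (𝓝 (S t x)) := by
    refine ((S t).continuous.tendsto x).comp ((hcont0 x).comp ?_)
    simpa using (continuous_sub_right t).tendsto t
  refine h1.congr fun r => ?_
  rw [← hadd, add_sub_cancel]

/-! ### Surjective skew-symmetric operators: skew-adjointness and generation. -/

/-- A surjective skew-symmetric operator is densely defined. -/
theorem dense_domain_of_surjective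
    (hskew : ∀ x y : A.domain, inner ℝ (A x) (y : H) = -inner ℝ (x : H) (A y))
    (hsurj : ∀ f, ∃ x : A.domain, A x = f) : Dense (A.domain : Set H) := by
  rw [Submodule.dense_iff_topologicalClosure_eq_top, Submodule.topologicalClosure_eq_top_iff,
    Submodule.eq_bot_iff]
  intro f hf
  -- If `A x` is orthogonal to the domain, skewness makes `x` orthogonal to the range, hence to
  -- itself.
  obtain ⟨x, rfl⟩ := hsurj f
  have h : ∀ y : A.domain, inner ℝ (x : H) (A y) = 0 := fun y => by
    have h1 := hskew x y
    rw [real_inner_comm, (Submodule.mem_orthogonal _ _).1 hf y y.2] at h1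
    linarith
  obtain ⟨y, hy⟩ := hsurj x
  have hx : (x : H) = 0 := by
    have := h y
    rwa [hy, inner_self_eq_zero] at this
  rw [show x = 0 from Subtype.ext hx, LinearPMap.map_zero]

/-- Skew-symmetry gives `-A ≤ A*`. Conversely, for `y` in the domain of `A*`, maximality applied to
`z = -A* y` puts `y` in the domain of `A`. -/
theorem isSkewAdjoint_of_surjective
    (hskew : ∀ x y : A.domain, inner ℝ (A x) (y : H) = -inner ℝ (x : H) (A y))
    (hsurj : ∀ f, ∃ x : A.domain, A x = f) : IsSkewAdjoint A := by
  have hd := dense_domain_of_surjective hskew hsurj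
  have hle : -A ≤ A.adjoint := by
    refine LinearPMap.IsFormalAdjoint.le_adjoint hd ?_
    intro x y
    have := hskew x y
    rw [LinearPMap.neg_apply, inner_neg_right]
    exact this
  refine ⟨hd, (LinearPMap.eq_of_le_of_domain_eq hle (le_antisymm hle.1 ?_)).symm⟩
  intro y hy
  obtain ⟨h, -⟩ := mem_graph_of_formal hskew hsurj (y := y) (z := -A.adjoint ⟨y, hy⟩) (fun x => by
    have := LinearPMap.adjoint_isFormalAdjoint hd ⟨y, hy⟩ x
    rw [inner_neg_right, neg_neg, real_inner_comm, ← this, real_inner_comm])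
  exact h

theorem exists_group_of_surjective
    (hskew : ∀ x y : A.domain, inner ℝ (A x) (y : H) = -inner ℝ (x : H) (A y))
    (hsurj : ∀ f, ∃ x : A.domain, A x = f) :
    ∃ G : C0Group H, G.IsGenerator A ∧ G.IsIsometric := by
  have hinj : ∀ x : A.domain, A x = 0 → x = 0 := fun x hx => by
    obtain ⟨y, hy⟩ := hsurj x
    have := hskew x y
    rw [hx, inner_zero_left, hy, zero_eq_neg, inner_self_eq_zero] at this
    exact Subtype.ext this
  let e : A.domain ≃ₗ[ℝ] H := LinearEquiv.ofBijective A.toFun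
    ⟨(injective_iff_map_eq_zero _).2 hinj, hsurj⟩
  have he : ∀ f, A (e.symm f) = f := e.apply_symm_apply
  let K₀ : H →ₗ[ℝ] H := A.domain.subtype ∘ₗ e.symm.toLinearMap
  have hK₀ : ∀ x y, inner ℝ (K₀ x) y = -inner ℝ x (K₀ y) := fun x y => by
    have := hskew (e.symm x) (e.symm y)
    rw [he, he] at this
    change inner ℝ ((e.symm x : A.domain) : H) y = -inner ℝ x ((e.symm y : A.domain) : H)
    rw [this, neg_neg]
  -- Hellinger–Toeplitz: an everywhere defined skew operator has closed graph, since pairing with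
  -- `v` moves it onto `v`.
  have hcont : Continuous K₀ := by
    refine K₀.continuous_of_seq_closed_graph fun u x y hu hKu => ?_
    refine ext_inner_right ℝ fun v => tendsto_nhds_unique (hKu.inner tendsto_const_nhds) ?_
    simp only [Function.comp_apply, hK₀]
    exact (hu.inner tendsto_const_nhds).neg
  let K : H →L[ℝ] H := ⟨K₀, hcont⟩
  have hK : IsSkew K := hK₀
  have hKA : ∀ x : A.domain, K (A x) = x := fun x =>
    congrArg Subtype.val (e.symm_apply_apply x)
  have hd : DenseRange K := (dense_domain_of_surjective hskew hsurj).mono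
    fun x hx => ⟨A ⟨x, hx⟩, hKA ⟨x, hx⟩⟩
  obtain ⟨G, hG, hGK⟩ := hK.exists_group hd
  have hder : ∀ x : A.domain,
      Tendsto (fun t : ℝ => t⁻¹ • (G.S t x - x)) (𝓝[≠] 0) (𝓝 (A x)) := fun x => by
    have := hGK (A x)
    rwa [hKA] at this
  refine ⟨G, fun x y => ⟨fun h => ?_, fun h => ?_⟩, hG⟩
  · obtain ⟨z, rfl, rfl⟩ := (LinearPMap.mem_graph_iff A).1 h
    exact hder z
  · have hinner : ∀ t u v, inner ℝ (G.S t u) (G.S t v) = (inner ℝ u v : ℝ) := fun t =>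
      (LinearMap.toLinearIsometry (G.S t).toLinearMap (hG t)).inner_map_map
    -- Since `S(t)` preserves inner products, `⟨S(t) z - z, S(t) x⟩ = -⟨z, S(t) x - x⟩`. Dividing by
    -- `t` and letting `t → 0` yields `⟨A z, x⟩ = -⟨z, y⟩`.
    obtain ⟨hx, hxy⟩ := mem_graph_of_formal hskew hsurj (y := x) (z := y) fun z => by
      have hl : Tendsto (fun t : ℝ => inner ℝ ((t⁻¹ • (G.S t z - z) : H)) (G.S t x)) (𝓝[≠] 0)
          (𝓝 (inner ℝ (A z) x)) := by
        have h0 : Tendsto (fun t => G.S t x) (𝓝[≠] 0) (𝓝 x) := by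
          have := (G.continuous_orbit x).tendsto 0
          rw [G.map_zero] at this
          exact this.mono_left nhdsWithin_le_nhds
        exact (hder z).inner h0
      refine tendsto_nhds_unique hl ?_
      have hr := (tendsto_const_nhds (x := (z : H)) (f := 𝓝[≠] (0 : ℝ))).inner (𝕜 := ℝ) h
      refine hr.neg.congr fun t => ?_
      simp only [inner_smul_left, inner_smul_right, inner_sub_left, inner_sub_right, hinner,
        conj_trivial]
      ring
    exact (LinearPMap.mem_graph_iff A).2 ⟨⟨x, hx⟩, rfl, hxy⟩

end Group

/-! ### Integration by parts and boundary values in `H¹(0, L)`. -/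

section Sobolev

variable {L : ℝ}

theorem prim_absolutelyContinuous (g : L2 L) : AbsolutelyContinuousOnInterval (prim g) 0 L :=
  (integrable_ind g).intervalIntegrable.absolutelyContinuousOnInterval_intervalIntegral
    (c := 0) (by simp)

variable [hL : Fact (0 < L)]

theorem exists_isContRep_prim {u : L2 L} (hu : u ∈ H1 L) :
    ∃ c, IsContRep u (fun x => c + prim (wderiv u) x) := by
  obtain ⟨c, hc⟩ := (hasWeakDeriv_wderiv hu).exists_ae_eq hL.out
  exact ⟨c, (continuous_const.add (prim_cont _)).continuousOn, hc⟩

theorem isContRep_prim {u : L2 L} (hu : u ∈ H1star L) : IsContRep u (prim (wderiv u)) :=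
  ⟨(prim_cont _).continuousOn, ae_eq_prim hu⟩

theorem abs_value_le {u : L2 L} (hu : u ∈ H1star L) : |value L u| ≤ √L * ‖wderiv u‖ := by
  rw [(isContRep_prim hu).value_eq (right_mem_Icc' L)]
  exact abs_prim_le hL.out _ (right_mem_Icc' L)

theorem ae_hasDerivAt_prim (g : L2 L) :
    ∀ᵐ x ∂(volume.restrict (Ioo 0 L)), HasDerivAt (prim g) (g x) x := by
  have hi : IntervalIntegrable ((Ioo 0 L).indicator (g : ℝ → ℝ)) volume 0 L :=
    (integrable_ind g).intervalIntegrable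
  filter_upwards [ae_restrict_of_ae hi.ae_hasDerivAt_integral, ae_restrict_mem measurableSet_Ioo]
    with x hx hx2
  have := hx (by rw [uIcc_of_le hL.out.le]; exact Ioo_subset_Icc_self hx2) 0 (by simp)
  rwa [indicator_of_mem hx2] at this

/-- Integration by parts in `H¹(0, L)`. -/
theorem inner_wderiv_left {u v : L2 L} (hu : u ∈ H1 L) (hv : v ∈ H1star L) :
    inner ℝ (wderiv u) v = value L u * value L v - inner ℝ u (wderiv v) := by
  obtain ⟨c, hc⟩ := exists_isContRep_prim hu
  have hv' := isContRep_prim hv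
  have h1 : AbsolutelyContinuousOnInterval (fun x => c + prim (wderiv u) x) 0 L :=
    (contDiff_const (n := 1)).contDiffOn.absolutelyContinuousOnInterval.add
      (prim_absolutelyContinuous _)
  have h := h1.integral_mul_deriv_eq_deriv_mul (prim_absolutelyContinuous (wderiv v))
  -- Only the boundary term at `L` remains: the representative of `v` vanishes at `0`, where `u` is
  -- free.
  rw [intervalIntegral.integral_of_le hL.out.le, intervalIntegral.integral_of_le hL.out.le,
    integral_Ioc_eq_integral_Ioo, integral_Ioc_eq_integral_Ioo, prim_zero (wderiv v),
    mul_zero, sub_zero] at h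
  rw [hc.value_eq (right_mem_Icc' L), hv'.value_eq (right_mem_Icc' L), L2.inner_def, L2.inner_def]
  have e1 : ∫ x in Ioo 0 L, inner ℝ (u x) (wderiv v x)
      = ∫ x in Ioo 0 L, (c + prim (wderiv u) x) * deriv (prim (wderiv v)) x := by
    apply integral_congr_ae
    filter_upwards [hc.2, ae_hasDerivAt_prim (wderiv v)] with x hx hx2
    rw [hx, hx2.deriv, RCLike.inner_apply, conj_trivial, mul_comm]
  have e2 : ∫ x in Ioo 0 L, inner ℝ (wderiv u x) (v x)
      = ∫ x in Ioo 0 L, deriv (fun x => c + prim (wderiv u) x) x * prim (wderiv v) x := by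
    apply integral_congr_ae
    filter_upwards [hv'.2, ae_hasDerivAt_prim (wderiv u)] with x hx hx2
    rw [hx, (hx2.const_add c).deriv, RCLike.inner_apply, conj_trivial, mul_comm]
  rw [e1, e2, h]
  ring

theorem integral_deriv_test {φ : ℝ → ℝ} (hφ : IsTestFun L φ) :
    ∫ x in Ioo 0 L, deriv φ x = 0 := by
  rw [← integral_Ioc_eq_integral_Ioo, ← intervalIntegral.integral_of_le hL.out.le,
    intervalIntegral.integral_deriv_eq_sub
      (fun x _ => (hφ.contDiff.differentiable (by simp)).differentiableAt)
      (hφ.deriv_cont.intervalIntegrable _ _)]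
  have h : ∀ x, x ∉ Ioo 0 L → φ x = 0 := fun x hx =>
    image_eq_zero_of_notMem_tsupport fun h => hx (hφ.tsupport_subset h)
  rw [h L (by simp), h 0 (by simp), sub_zero]

/-- The primitive of `g ∈ L²(0, L)` with a prescribed value at `L`. -/
theorem exists_wderiv_eq_value_eq (g : L2 L) (c : ℝ) :
    ∃ u ∈ H1 L, wderiv u = g ∧ value L u = c := by
  -- The additive constant that corrects the value at `L`; the value at `0` is left uncontrolled.
  set d := c - prim g L
  have hm : MemLp (fun x => d + prim g x) 2 (volume.restrict (Ioo 0 L)) :=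
    (memLp_const d).add (prim_memLp g)
  let u : L2 L := hm.toLp _
  have hu : (u : ℝ → ℝ) =ᵐ[volume.restrict (Ioo 0 L)] fun x => d + prim g x :=
    MemLp.coeFn_toLp _
  have hw : HasWeakDeriv u g := by
    intro φ hφ
    have e : ∫ x in Ioo 0 L, u x * deriv φ x
        = ∫ x in Ioo 0 L, (d * deriv φ x + prim g x * deriv φ x) := by
      apply integral_congr_ae
      filter_upwards [hu] with x hx
      rw [hx, add_mul]
    have i : ∀ {f : ℝ → ℝ}, Continuous f → IntegrableOn f (Ioo 0 L) := fun hf =>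
      (hf.integrableOn_Icc (a := 0) (b := L)).mono_set Ioo_subset_Icc_self
    rw [e, integral_add (f := fun x => d * deriv φ x) (g := fun x => prim g x * deriv φ x)
      (i (continuous_const.mul hφ.deriv_cont)) (i ((prim_cont g).mul hφ.deriv_cont)),
      integral_const_mul, integral_deriv_test hφ, mul_zero, zero_add, prim_parts g hφ]
  refine ⟨u, ⟨g, hw⟩, hw.wderiv_eq, ?_⟩
  have : IsContRep u (fun x => d + prim g x) :=
    ⟨(continuous_const.add (prim_cont g)).continuousOn, hu⟩
  rw [this.value_eq (right_mem_Icc' L)]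
  exact sub_add_cancel _ _

end Sobolev

/-! ### Skew-symmetry and surjectivity of the beam operator. -/

section Beam

variable {P : Params}

theorem norm_wderiv_s_le (U : Phase P) : ‖wderiv U.s‖ ≤ (√P.b)⁻¹ * ‖U‖ := by
  obtain ⟨h1, h2, h3, h4, h5⟩ := And.intro P.ρ₁_pos (And.intro P.ρ₂_pos
    (And.intro P.k_pos (And.intro P.b_pos P.γ_pos)))
  rw [le_inv_mul_iff₀ (Real.sqrt_pos.2 h4)]
  refine (pow_le_pow_iff_left₀ (by positivity) (norm_nonneg _) two_ne_zero).1 ?_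
  rw [mul_pow, Real.sq_sqrt h4.le, Phase.norm_sq_eq, Phase.ip_self]
  have : 0 ≤ 3 * P.ρ₁ * ‖U.ψ₁‖ ^ 2 + 3 * P.ρ₂ * ‖U.ψ₂‖ ^ 2 + P.ρ₂ * ‖U.ψ₃‖ ^ 2
    + 3 * P.b * ‖wderiv U.ξ‖ ^ 2 + P.γ * ‖U.s‖ ^ 2 + 3 * P.k * ‖U.shear‖ ^ 2
    + 3 * P.k * U.ψ₄ ^ 2 + 3 * P.b * U.ψ₅ ^ 2 + P.b * U.ψ₆ ^ 2 := by positivity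
  linarith

/-- The functional `U ↦ ⟨h, s⟩ + c s(L)`. -/
noncomputable def slipFunctional (P : Params) (h : L2 P.L) (c : ℝ) : Phase P →L[ℝ] ℝ :=
  LinearMap.mkContinuous
    { toFun := fun U => inner ℝ h U.s + c * value P.L U.s
      map_add' := fun U V => by
        rw [Phase.s_add, inner_add_right, value_add (right_mem_Icc' P.L) U.s_mem.1 V.s_mem.1]
        ring
      map_smul' := fun r U => by
        rw [Phase.s_smul, real_inner_smul_right, value_smul (right_mem_Icc' P.L) r U.s_mem.1,
          RingHom.id_apply, smul_eq_mul]
        ring }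
    -- Poincaré inequality for `⟨h, s⟩`, trace bound for `s(L)`, and `√b ‖s_x‖ ≤ ‖U‖`.
    ((‖h‖ * P.L + |c| * √P.L) * (√P.b)⁻¹) fun U => by
      have hL := P.L_pos
      have h1 : |inner ℝ h U.s| ≤ ‖h‖ * (P.L * ‖wderiv U.s‖) :=
        (abs_real_inner_le_norm _ _).trans
          (mul_le_mul_of_nonneg_left (norm_le_wderiv U.s_mem) (norm_nonneg _))
      have h2 : |c * value P.L U.s| ≤ |c| * (√P.L * ‖wderiv U.s‖) := by
        rw [abs_mul]
        exact mul_le_mul_of_nonneg_left (abs_value_le U.s_mem) (abs_nonneg _)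
      have h3 : (‖h‖ * P.L + |c| * √P.L) * ‖wderiv U.s‖
          ≤ (‖h‖ * P.L + |c| * √P.L) * ((√P.b)⁻¹ * ‖U‖) :=
        mul_le_mul_of_nonneg_left (norm_wderiv_s_le U) (by positivity)
      change |inner ℝ h U.s + c * value P.L U.s| ≤ _
      linarith [abs_add_le (inner ℝ h U.s) (c * value P.L U.s)]

/-- Weak solvability of `b s_xx - γ s = -h`, `s(0) = 0`, `b s_x(L) = c`. -/
theorem exists_weak_slip (P : Params) (h : L2 P.L) (c : ℝ) :
    ∃ s ∈ H1star P.L, ∀ v ∈ H1star P.L,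
      P.b * inner ℝ (wderiv s) (wderiv v) + P.γ * inner ℝ s v = inner ℝ h v + c * value P.L v := by
  -- Riesz representation is used in the phase space itself, which is already known to be complete.
  obtain ⟨U, hU⟩ := (InnerProductSpace.toDual ℝ (Phase P)).surjective (slipFunctional P h c)
  refine ⟨U.s, U.s_mem, fun v hv => ?_⟩
  -- Choosing `w_x = -v` kills the shear of the test element, so only the `s`-terms of the inner
  -- product survive.
  obtain ⟨w, hw, hw'⟩ := exists_wderiv_eq (-v)
  let V : Phase P := Phase.mk ⟨w, hw⟩ 0 0 0 ⟨v, hv⟩ 0 0 0 0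
  have e : Phase.ip U V = inner ℝ h v + c * value P.L v := DFunLike.congr_fun hU V
  have hs : V.shear = 0 := by
    change wderiv w + 0 + v = 0
    rw [hw']; abel
  have hz : wderiv V.ξ = 0 := HasWeakDeriv.zero.wderiv_eq
  rw [← e, Phase.ip, hs, hz]
  simp [V]

/-- Regularity: let `G` be the primitive of `b⁻¹ (h + γ s)` with `G(L) = c`. The weak equation and
integration by parts give `⟨s_x, v_x⟩ = ⟨G, v_x⟩` for all `v` in `H¹_*`. Since `v_x` runs through
all of `L²`, `s_x = G`. -/
theorem exists_slip (P : Params) (h : L2 P.L) (c : ℝ) :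
    ∃ s ∈ H2 P.L ⊓ H1star P.L, P.b • wderiv (wderiv s) - P.γ • s = h ∧
      value P.L (wderiv s) = c := by
  obtain ⟨s, hs, hw⟩ := exists_weak_slip P (-h) (P.b * c)
  obtain ⟨G, hG, hG', hGL⟩ := exists_wderiv_eq_value_eq (P.b⁻¹ • (h + P.γ • s)) c
  have hb := P.b_pos.ne'
  have e : wderiv s = G := by
    refine ext_inner_right ℝ fun y => ?_
    obtain ⟨v, hv, rfl⟩ := exists_wderiv_eq y
    have h1 := hw v hv
    have h2 := inner_wderiv_left hG hv
    rw [hG', hGL, real_inner_smul_left, inner_add_left, real_inner_smul_left,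
      inv_mul_eq_iff_eq_mul₀ hb] at h2
    rw [inner_neg_left] at h1
    refine mul_left_cancel₀ hb ?_
    linarith
  subst e
  refine ⟨s, ⟨⟨hs.1, hG⟩, hs⟩, ?_, hGL⟩
  rw [hG', smul_inv_smul₀ hb, add_sub_cancel_right]

theorem value_shear {U : Phase P} (hU : U ∈ beamDomain P) :
    value P.L U.shear = value P.L (wderiv U.w) + value P.L U.ξ + value P.L U.s := by
  have hx := right_mem_Icc' P.L
  rw [Phase.shear, value_add hx (add_mem hU.1.1.1.2 hU.1.2.1.1.1) hU.1.2.2.1.1,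
    value_add hx hU.1.1.1.2 hU.1.2.1.1.1]

/-- The energy form pairing the velocities of `U` with the displacements of `V`. -/
noncomputable def energyForm (U V : Phase P) : ℝ :=
  3 * P.b * inner ℝ (wderiv U.ψ₂) (wderiv V.ξ) + P.b * inner ℝ (wderiv U.ψ₃) (wderiv V.s)
    + P.γ * inner ℝ U.ψ₃ V.s + 3 * P.k * inner ℝ (wderiv U.ψ₁ + U.ψ₂ + U.ψ₃) V.shear

/-- Integrating by parts the second-order terms produces boundary terms at `L`; as `Ψ₄, Ψ₅, Ψ₆` of
`V` are the traces of its velocities, they cancel against the last three components of `𝒜 U`. The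
weights of the inner product give every shear term the factor `3k`, so what is left is
antisymmetric. -/
theorem inner_beamFun {U V : Phase P} (hU : U ∈ beamDomain P) (hV : V ∈ beamDomain P) :
    Phase.ip (beamFun U hU) V = energyForm U V - energyForm V U := by
  have h1 := inner_wderiv_left (shear_mem hU) hV.2.1.1
  have h2 := inner_wderiv_left hU.1.2.1.1.2 hV.2.1.2.1
  have h3 := inner_wderiv_left hU.1.2.2.1.2 hV.2.1.2.2
  rw [← hV.2.2.1, value_shear hU] at h1
  rw [← hV.2.2.2.1] at h2
  rw [← hV.2.2.2.2] at h3
  have hρ₁ := P.ρ₁_pos.ne'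
  have hρ₂ := P.ρ₂_pos.ne'
  have es : (beamFun U hU).shear = wderiv U.ψ₁ + U.ψ₂ + U.ψ₃ := rfl
  simp only [Phase.ip, energyForm, es]
  simp only [beamFun, Phase.mk_ψ₁, Phase.mk_ξ, Phase.mk_ψ₂, Phase.mk_s, Phase.mk_ψ₃,
    Phase.mk_ψ₄, Phase.mk_ψ₅, Phase.mk_ψ₆, real_inner_smul_left, inner_sub_left, inner_add_left,
    inner_add_right, h1, h2, h3, real_inner_comm U.shear, real_inner_comm U.s,
    real_inner_comm (wderiv U.ξ), real_inner_comm (wderiv U.s)]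
  field_simp
  ring

theorem beamOp_skew (U V : (beamOp P).domain) :
    inner ℝ (beamOp P U) (V : Phase P) = -inner ℝ (U : Phase P) (beamOp P V) := by
  rw [real_inner_comm _ (U : Phase P)]
  have h1 : inner ℝ (beamOp P U) (V : Phase P) = _ := inner_beamFun U.2 V.2
  have h2 : inner ℝ (beamOp P V) (U : Phase P) = _ := inner_beamFun V.2 U.2
  rw [h1, h2, neg_sub]

theorem beamOp_surjective (F : Phase P) : ∃ U : (beamOp P).domain, beamOp P U = F := by
  have hx := right_mem_Icc' P.L
  have hρ₁ := P.ρ₁_pos.ne'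
  have hρ₂ := P.ρ₂_pos.ne'
  have hk := P.k_pos.ne'
  have hb := P.b_pos.ne'
  -- The shear is found before the displacements: the `Ψ₁`-equation gives `σ_x`, and the
  -- `Ψ₄`-equation gives `σ(L)`. With `σ` known, the equations for `ξ` and `s` decouple; `τ` is
  -- `ξ_x`, and only `s` needs the elliptic problem, owing to `γ s`.
  obtain ⟨σ, hσ, hσ', hσL⟩ := exists_wderiv_eq_value_eq ((P.ρ₁ / P.k) • F.ψ₁) (-F.ψ₄)
  obtain ⟨τ, hτ, hτ', hτL⟩ :=
    exists_wderiv_eq_value_eq (P.b⁻¹ • (P.ρ₂ • F.ψ₂ + P.k • σ)) (-F.ψ₅)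
  obtain ⟨ξ, hξ, hξ'⟩ := exists_wderiv_eq τ
  obtain ⟨s, hs, hs', hsL⟩ := exists_slip P (P.ρ₂ • F.ψ₃ + (3 * P.k) • σ) (-F.ψ₆)
  -- This choice makes the shear of the solution equal to the prescribed `σ`.
  obtain ⟨w, hw, hw'⟩ := exists_wderiv_eq (σ - ξ - s)
  have hshear : wderiv w + ξ + s = σ := by rw [hw']; abel
  -- The displacements of `F` become the velocities of `U`; they lie in `H¹_*` as the domain
  -- requires, and `Ψ₄, Ψ₅, Ψ₆` must be their traces.
  let U : Phase P := Phase.mk ⟨w, hw⟩ F.w ⟨ξ, hξ⟩ F.ξ ⟨s, hs.2⟩ F.s (value P.L F.w)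
    (value P.L F.ξ) (value P.L F.s)
  have hwx : wderiv w ∈ H1 P.L := by
    rw [hw']; exact sub_mem (sub_mem hσ hξ.1) hs.1.1
  have hU : U ∈ beamDomain P :=
    ⟨⟨⟨⟨hw.1, hwx⟩, hw⟩, ⟨⟨hξ.1, hξ'.symm ▸ hτ⟩, hξ⟩, hs⟩,
      ⟨F.w_mem, F.ξ_mem, F.s_mem⟩, rfl, rfl, rfl⟩
  have eS : U.shear = σ := hshear
  refine ⟨⟨U, hU⟩, ?_⟩
  change beamFun U hU = F
  apply Phase.ext
  · rfl
  · rw [beamFun, Phase.mk_ψ₁, eS, hσ', smul_smul, smul_smul]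
    field_simp
    exact one_smul ℝ _
  · rfl
  · rw [beamFun, Phase.mk_ψ₂, eS, show U.ξ = ξ from rfl, hξ', hτ', smul_inv_smul₀ hb,
      add_sub_cancel_right, one_div, inv_smul_smul₀ hρ₂]
  · rfl
  · rw [beamFun, Phase.mk_ψ₃, eS, show U.s = s from rfl, sub_right_comm, hs',
      add_sub_cancel_right, one_div, inv_smul_smul₀ hρ₂]
  · rw [beamFun, Phase.mk_ψ₄, ← value_shear hU, eS, hσL, neg_neg]
  · rw [beamFun, Phase.mk_ψ₅, show U.ξ = ξ from rfl, hξ', hτL, neg_neg]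
  · rw [beamFun, Phase.mk_ψ₆, show U.s = s from rfl, hsL, neg_neg]

end Beam

end LaminatedBeam

theorem mainTheorem6 (P : LaminatedBeam.Params) :
    LaminatedBeam.IsSkewAdjoint (LaminatedBeam.beamOp P) ∧
      ∃ S : LaminatedBeam.C0Group (LaminatedBeam.Phase P),
        S.IsGenerator (LaminatedBeam.beamOp P) ∧ S.IsIsometric :=
  ⟨LaminatedBeam.isSkewAdjoint_of_surjective LaminatedBeam.beamOp_skew
      LaminatedBeam.beamOp_surjective,
    LaminatedBeam.exists_group_of_surjective LaminatedBeam.beamOp_skew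
      LaminatedBeam.beamOp_surjective⟩
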